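/- Let $n_1,n_2\ge 0$ and $n=n_1+n_2$. All matrices are complex; $\langle A,B\rangle=\mathrm{tr}(A^HB)$ and $\|A\|^2=\langle A,A\rangle$ (for Hermitian matrices these are real), $[A]^+$ denotes the projection of a matrix $A$ onto the cone of positive semidefinite matrices (the nearest point of the cone in $\|\cdot\|$), $[a]^+=\max(a,0)$ for real $a$, and $\lambda_{\max}$ is the largest eigenvalue of a Hermitian matrix (read as $0$ for the empty matrix). Let $P>0$, $\rho>0$, $\tau>0$, let $\check X\in\mathbb C^{n\times n}$ and $Z\in\mathbb C^{n_1\times n_1}$ be Hermitian, let $D_1\in\mathbb C^{n_1\times n_1}$ be positive definite, and let $\mathcal Q=\{Q: Q\succeq 0,\ \mathrm{tr}(Q)\le P\}$ (in either dimension). For $\tilde X\in\mathbb C^{n\times n}$ let $\tilde X_{11}$ be its leading $n_1\times n_1$ block. A real $\mu$ is called a multiplier of the trace constraint at $Q\in\mathcal Q$, for the maximization of $f$ over $\mathcal Q$, if $0\le\mu\perp \mathrm{tr}(Q)-P\le 0$ (that is, $\mu\ge0$, $\mathrm{tr}(Q)\le P$, $\mu(\mathrm{tr}(Q)-P)=0$)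 and $Q$ maximizes $W\mapsto f(W)-\mu(\mathrm{tr}(W)-P)$ over $W\succeq0$. Bisection for a point on an interval $[a,b]$ repeatedly halves the interval at its midpoint $\nu$, keeping the upper half if the trace of the candidate matrix at $\nu$ exceeds $P$ and the lower half otherwise. (i) The problem $$\max_{\tilde X\in\mathcal Q}\ -\tau\|\tilde X-\check X\|^2-\langle Z,\tilde X_{11}\rangle$$ has exactly one maximizer $\tilde X(Z)$. There is exactly one multiplier $\mu^\star$ of the trace constraint at $\tilde X(Z)$, and $\tilde X(Z)=X_{\mu^\star}$, where $$X_\nu=\left[\check X-\frac1{2\tau}\left(\nu I+\begin{bmatrix}Z&0\\0&0\end{bmatrix}\right)\right]^+ .$$ Moreover $\mu^\star$ is the only real $\nu$ with $0\le\nu\perp\mathrm{tr}(X_\nu)-P\le0$. It can be found by bisection: $\mathrm{tr}(X_b)\le P$ for all sufficiently large $b$, and for every $b\ge0$ with $\mathrm{tr}(X_b)\le P$ the bisection on $[0,b]$ with candidates $X_\nu$ produces, for every $t\ge 0$, after $t$ steps an interval of length $b/2^t$ that contains $\mu^\star$. (ii) The problem $$\max_{Y\in\mathcal Q}\ \rho\log\det(I+YD_1)+\langle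 Z,Y\rangle$$ has exactly one maximizer $Y(Z)$, and there is exactly one multiplier $\mu^\star$ of the trace constraint at $Y(Z)$. By a generalized eigenvalue decomposition of $(D_1,-Z+\nu I)$ we mean a pair $(V,\Sigma)$ with $\Sigma$ real diagonal, $D_1V=(-Z+\nu I)V\Sigma$ and $V^H(-Z+\nu I)V=I$. Such a decomposition exists for $\nu=\mu^\star$, and for each one $$Y(Z)=V\,[\rho I-\Sigma^{-1}]^+\,V^H .$$ Moreover $\mu^\star$ is the only real $\nu$ for which $(D_1,-Z+\nu I)$ has a generalized eigenvalue decomposition $(V,\Sigma)$ such that $Y_\nu=V[\rho I-\Sigma^{-1}]^+V^H$ satisfies $0\le\nu\perp\mathrm{tr}(Y_\nu)-P\le0$. If $\rho\le1$, then $\mu^\star$ lies in $[\underline\mu,\overline\mu]$ with $$\underline\mu=[\lambda_{\max}(Z)]^+,\qquad \overline\mu=\left[\lambda_{\max}(D_1)+\lambda_{\max}(Z)/\rho\right]^+ ,$$ and it can be found by bisection on this interval with candidates $Y_\nu$: at every midpoint $\nu$ that occurs, a decomposition exists and $Y_\nu$ does not depend on the choice of it, and for every $t\ge0$ the interval after $t$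 steps has length $(\overline\mu-\underline\mu)/2^t$ and contains $\mu^\star$. -/

import Mathlib

open Matrix
open scoped ComplexOrder

/-- `⟨A, B⟩ = tr (Aᴴ B)`; the real part is taken because the value is real for Hermitian matrices,
and for `B = A`. -/
noncomputable def frobInner {n : Type*} [Fintype n] (A B : Matrix n n ℂ) : ℝ :=
  (Aᴴ * B).trace.re

/-- `‖A‖² = ⟨A, A⟩`, the squared Frobenius norm. -/
noncomputable def frobSq {n : Type*} [Fintype n] (A : Matrix n n ℂ) : ℝ :=
  frobInner A A

/-- `tr A` as a real number, for Hermitian `A`. -/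
noncomputable def reTrace {n : Type*} [Fintype n] (A : Matrix n n ℂ) : ℝ :=
  A.trace.re

/-- `B` is the Frobenius-nearest point to `A` in the cone of positive semidefinite matrices. -/
def IsPSDProj {n : Type*} [Fintype n] (A B : Matrix n n ℂ) : Prop :=
  B.PosSemidef ∧ ∀ C : Matrix n n ℂ, C.PosSemidef → C ≠ B → frobSq (A - B) < frobSq (A - C)

theorem frobSq_eq_norm_sq {n : Type*} [Fintype n] (A : Matrix n n ℂ) :
    frobSq A = ‖(WithLp.toLp 2 (fun p : n × n => A p.1 p.2) : EuclideanSpace ℂ (n × n))‖ ^ 2 := by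
  rw [EuclideanSpace.norm_sq_eq, Fintype.sum_prod_type, Finset.sum_comm]
  simp only [frobSq, frobInner, Matrix.trace, Matrix.diag, Matrix.mul_apply,
    Matrix.conjTranspose_apply, Complex.re_sum]
  refine Finset.sum_congr rfl fun i _ => Finset.sum_congr rfl fun j _ => ?_
  rw [Complex.star_def, ← Complex.normSq_eq_conj_mul_self, Complex.ofReal_re,
    Complex.normSq_eq_norm_sq]

theorem exists_isPSDProj {n : Type*} [Fintype n] (A : Matrix n n ℂ) :
    ∃ B, IsPSDProj A B := by
  let toV : Matrix n n ℂ → EuclideanSpace ℂ (n × n) := fun M => WithLp.toLp 2 (fun p : n × n => M p.1 p.2)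
  let toM : EuclideanSpace ℂ (n × n) → Matrix n n ℂ := fun v => Matrix.of fun i j => v (i, j)
  let K : Set (EuclideanSpace ℂ (n × n)) := {v | (toM v).PosSemidef}
  have hsub : ∀ M N : Matrix n n ℂ, toV (M - N) = toV M - toV N := fun M N => rfl
  have hconv : Convex ℝ K := by
    intro x hx y hy a b ha hb _
    have h : toM (a • x + b • y) = a • toM x + b • toM y := by
      ext i j
      simp [toM]
    change (toM (a • x + b • y)).PosSemidef
    rw [h]
    exact (Matrix.PosSemidef.smul hx ha).add (Matrix.PosSemidef.smul hy hb)
  have hclosed : IsClosed K := by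
    have hK : K = {v : EuclideanSpace ℂ (n × n) | (toM v)ᴴ = toM v} ∩
        ⋂ x : n → ℂ, {v : EuclideanSpace ℂ (n × n) | 0 ≤ star x ⬝ᵥ (toM v *ᵥ x)} := by
      ext v
      simp only [K, Set.mem_ofPred_eq, Set.mem_inter_iff, Set.mem_iInter]
      rw [Matrix.posSemidef_iff_dotProduct_mulVec]
      rfl
    have hc : Continuous toM := by
      refine continuous_matrix fun i j => ?_
      change Continuous fun v : EuclideanSpace ℂ (n × n) => v (i, j)
      fun_prop
    rw [hK]
    refine (isClosed_eq hc.matrix_conjTranspose hc).inter (isClosed_iInter fun x => ?_)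
    refine isClosed_Ici.preimage (f := fun v : EuclideanSpace ℂ (n × n) => star x ⬝ᵥ (toM v *ᵥ x)) ?_
    exact continuous_const.dotProduct (hc.matrix_mulVec continuous_const)
  have hne : K.Nonempty := ⟨toV 0, Matrix.PosSemidef.zero⟩
  obtain ⟨v, hvK, hv⟩ :=
    exists_norm_eq_iInf_of_complete_convex hne hclosed.isComplete hconv (toV A)
  rw [norm_eq_iInf_iff_real_inner_le_zero hconv hvK] at hv
  refine ⟨toM v, hvK, fun C hC hCv => ?_⟩
  rw [frobSq_eq_norm_sq, frobSq_eq_norm_sq]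
  change ‖toV (A - toM v)‖ ^ 2 < ‖toV (A - C)‖ ^ 2
  have hv' : toV (toM v) = v := rfl
  rw [hsub, hsub, hv']
  have h1 := hv (toV C) hC
  have h2 : ‖toV A - toV C‖ ^ 2 = ‖toV A - v‖ ^ 2
      - 2 * inner ℝ (toV A - v) (toV C - v) + ‖toV C - v‖ ^ 2 := by
    rw [← norm_sub_sq_real]
    congr 2
    abel
  have h3 : 0 < ‖toV C - v‖ := by
    rw [norm_pos_iff, sub_ne_zero]
    intro h
    apply hCv
    rw [← h]
    rfl
  nlinarith [sq_pos_of_pos h3]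

/-- `[A]⁺`, the projection of `A` onto the cone of positive semidefinite matrices. -/
noncomputable def psdProj {n : Type*} [Fintype n] (A : Matrix n n ℂ) : Matrix n n ℂ :=
  Classical.choose (exists_isPSDProj A)

theorem isPSDProj_psdProj {n : Type*} [Fintype n] (A : Matrix n n ℂ) :
    IsPSDProj A (psdProj A) :=
  Classical.choose_spec (exists_isPSDProj A)

/-- `𝒬 = {Q : Q ⪰ 0, tr Q ≤ P}`. -/
def powerSet {n : Type*} [Fintype n] (P : ℝ) : Set (Matrix n n ℂ) :=
  {Q | Q.PosSemidef ∧ reTrace Q ≤ P}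

/-- The set of maximizers of `f` over `S`. -/
def argmaxOn {α : Type*} (f : α → ℝ) (S : Set α) : Set α :=
  {x | x ∈ S ∧ IsMaxOn f S x}

/-- `0 ≤ μ ⊥ tr Q - P ≤ 0`. -/
def TraceCompl {n : Type*} [Fintype n] (P : ℝ) (Q : Matrix n n ℂ) (μ : ℝ) : Prop :=
  0 ≤ μ ∧ reTrace Q - P ≤ 0 ∧ μ * (reTrace Q - P) = 0

/-- `μ` is a Lagrange multiplier of the constraint `tr Q ≤ P` at `Q`, for the maximization of `f`
over `powerSet P`: complementarity holds and `Q` maximizes the Lagrangian over the positive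
semidefinite cone. -/
def IsTraceMultiplier {n : Type*} [Fintype n] (f : Matrix n n ℂ → ℝ) (P : ℝ)
    (Q : Matrix n n ℂ) (μ : ℝ) : Prop :=
  TraceCompl P Q μ ∧
    Q ∈ argmaxOn (fun W => f W - μ * (reTrace W - P)) {W : Matrix n n ℂ | W.PosSemidef}

/-- The largest eigenvalue of a Hermitian matrix. -/
noncomputable def lamMax {n : Type*} [Fintype n] [DecidableEq n] {A : Matrix n n ℂ}
    (hA : A.IsHermitian) : ℝ :=
  ⨆ i, hA.eigenvalues i

/-- `(V, diag σ)` is a generalized eigenvalue decomposition of the pair `(A, B)`: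
`A V = B V diag(σ)`, with the usual normalization `Vᴴ B V = I`. -/
def IsGenEigDecomp {n : Type*} [Fintype n] [DecidableEq n] (A B V : Matrix n n ℂ)
    (σ : n → ℝ) : Prop :=
  A * V = B * V * diagonal (fun i => (σ i : ℂ)) ∧ Vᴴ * B * V = 1

/-- The objective `-τ ‖X - X̌‖² - ⟨Z, X₁₁⟩`. -/
noncomputable def objX {m k : Type*} [Fintype m] [Fintype k] (τ : ℝ)
    (Xc : Matrix (m ⊕ k) (m ⊕ k) ℂ) (Z : Matrix m m ℂ) (X : Matrix (m ⊕ k) (m ⊕ k) ℂ) : ℝ :=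
  -τ * frobSq (X - Xc) - frobInner Z X.toBlocks₁₁

/-- The objective `ρ log det (I + Y D₁) + ⟨Z, Y⟩`; the determinant is real and positive
for `Y ⪰ 0` and `D₁ ≻ 0`. -/
noncomputable def objY {m : Type*} [Fintype m] [DecidableEq m] (ρ : ℝ)
    (D₁ Z Y : Matrix m m ℂ) : ℝ :=
  ρ * Real.log (1 + Y * D₁).det.re + frobInner Z Y

/-- `[X̌ - (1 / 2τ) (μ I + blkdiag(Z, 0))]⁺`. -/
noncomputable def closedX {m k : Type*} [Fintype m] [Fintype k] [DecidableEq m] [DecidableEq k]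
    (τ : ℝ) (Xc : Matrix (m ⊕ k) (m ⊕ k) ℂ) (Z : Matrix m m ℂ) (μ : ℝ) :
    Matrix (m ⊕ k) (m ⊕ k) ℂ :=
  psdProj (Xc - (1 / (2 * τ)) • (μ • (1 : Matrix (m ⊕ k) (m ⊕ k) ℂ) + fromBlocks Z 0 0 0))

/-- `V [ρ I - Σ⁻¹]⁺ Vᴴ` with `Σ = diag σ`. -/
noncomputable def waterfill {m : Type*} [Fintype m] [DecidableEq m] (ρ : ℝ)
    (V : Matrix m m ℂ) (σ : m → ℝ) : Matrix m m ℂ :=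
  V * psdProj (ρ • (1 : Matrix m m ℂ) - (diagonal (fun i => (σ i : ℂ)))⁻¹) * Vᴴ

/-- `Y` is given by the formula `V [ρ I - Σ⁻¹]⁺ Vᴴ` for some generalized eigenvalue decomposition
`(V, Σ)` of `(D₁, -Z + μ I)`. -/
def IsClosedY {m : Type*} [Fintype m] [DecidableEq m] (ρ : ℝ) (D₁ Z : Matrix m m ℂ) (μ : ℝ)
    (Y : Matrix m m ℂ) : Prop :=
  ∃ (V : Matrix m m ℂ) (σ : m → ℝ),
    IsGenEigDecomp D₁ (-Z + μ • (1 : Matrix m m ℂ)) V σ ∧ Y = waterfill ρ V σ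

/-- The midpoint of an interval given by its endpoints. -/
noncomputable def midpt (I : ℝ × ℝ) : ℝ := (I.1 + I.2) / 2

open Classical in
/-- The intervals produced by bisection started at `[a, b]`: the upper half is kept when the
midpoint satisfies the test `above` (the sought point lies above it), the lower half otherwise. -/
noncomputable def bisect (above : ℝ → Prop) (a b : ℝ) : ℕ → ℝ × ℝ
  | 0 => (a, b)
  | t + 1 =>
    let I := bisect above a b t
    if above (midpt I) then (midpt I, I.2) else (I.1, midpt I)

/-! Both parts are Lagrangian duality with one scalar multiplier. For fixed `ν` the Lagrangian `f W
- ν (tr W - P)` has a unique maximizer `X ν` over the semidefinite cone for `ν` in an upper set `S`,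
and none otherwise. In (i), `S` is all of `ℝ`: completing the square turns the Lagrangian into a
negative squared distance (`objX_sub_eq`). In (ii), `S` lies above the spectrum of `Z`: the
congruence `W = V N Vᴴ` reduces it to `ρ log det (Σ⁻¹ + N) - tr N`, which waterfilling maximizes
(`argmaxOn_objY_sub`); off `S` it is unbounded (`argmaxOn_objY_sub_eq_empty`).

`exists_traceMultiplier` does the rest for both. The trace of `X ν` is continuous and antitone, and
strictly decreasing where positive, because a matrix maximizing two different Lagrangians has trace
zero. As `P > 0`, complementarity has exactly one solution `μ`, and the sign of `tr (X ν) - P` tells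
bisection on which side `μ` lies. Continuity rests on nonexpansiveness of the projection and, in
(ii), on a formula for `X ν` free of generalized eigenvectors (`shiftWaterfill`). -/

/-! ### Frobenius inner product -/

section frob

variable {n : Type*} [Fintype n]

theorem frobInner_add_left (A B C : Matrix n n ℂ) :
    frobInner (A + B) C = frobInner A C + frobInner B C := by
  simp [frobInner, add_mul]

theorem frobInner_sub_left (A B C : Matrix n n ℂ) :
    frobInner (A - B) C = frobInner A C - frobInner B C := by
  simp [frobInner, sub_mul]

theorem frobInner_sub_right (A B C : Matrix n n ℂ) :
    frobInner A (B - C) = frobInner A B - frobInner A C := by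
  simp [frobInner, mul_sub]

theorem frobInner_smul_left (c : ℝ) (A B : Matrix n n ℂ) :
    frobInner (c • A) B = c * frobInner A B := by
  simp [frobInner, conjTranspose_smul]

theorem frobInner_smul_right (c : ℝ) (A B : Matrix n n ℂ) :
    frobInner A (c • B) = c * frobInner A B := by
  simp [frobInner]

theorem frobInner_comm (A B : Matrix n n ℂ) : frobInner A B = frobInner B A := by
  have h : (Aᴴ * B).trace = star (Bᴴ * A).trace := by
    rw [← trace_conjTranspose, conjTranspose_mul, conjTranspose_conjTranspose]
  simp [frobInner, h]

theorem frobInner_of_isHermitian {A : Matrix n n ℂ} (hA : A.IsHermitian) (B : Matrix n n ℂ) :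
    frobInner A B = (A * B).trace.re := by
  rw [frobInner, hA.eq]

theorem frobInner_one [DecidableEq n] (A : Matrix n n ℂ) : frobInner 1 A = reTrace A := by
  simp [frobInner, reTrace]

theorem reTrace_smul (c : ℝ) (A : Matrix n n ℂ) : reTrace (c • A) = c * reTrace A := by
  simp [reTrace]

theorem reTrace_zero : reTrace (0 : Matrix n n ℂ) = 0 := by
  simp [reTrace]

theorem frobSq_nonneg (A : Matrix n n ℂ) : 0 ≤ frobSq A := by
  rw [frobSq_eq_norm_sq]; positivity

theorem frobSq_sub (A B : Matrix n n ℂ) :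
    frobSq (A - B) = frobSq A - 2 * frobInner A B + frobSq B := by
  simp only [frobSq, frobInner_sub_left, frobInner_sub_right, frobInner_comm B A]
  ring

theorem frobSq_smul (c : ℝ) (A : Matrix n n ℂ) : frobSq (c • A) = c ^ 2 * frobSq A := by
  simp only [frobSq, frobInner_smul_left, frobInner_smul_right]; ring

theorem norm_apply_sq_le_frobSq (A : Matrix n n ℂ) (i j : n) : ‖A i j‖ ^ 2 ≤ frobSq A := by
  rw [frobSq_eq_norm_sq, EuclideanSpace.norm_sq_eq]
  exact Finset.single_le_sum (f := fun p : n × n => ‖A p.1 p.2‖ ^ 2)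
    (fun _ _ => by positivity) (Finset.mem_univ (i, j))

theorem frobSq_pos {A : Matrix n n ℂ} (hA : A ≠ 0) : 0 < frobSq A := by
  obtain ⟨i, j, hij⟩ : ∃ i j, A i j ≠ 0 := by
    by_contra! h
    exact hA (Matrix.ext h)
  have := norm_apply_sq_le_frobSq A i j
  have : 0 < ‖A i j‖ := norm_pos_iff.2 hij
  nlinarith [norm_apply_sq_le_frobSq A i j]

theorem continuous_frobSq : Continuous (frobSq : Matrix n n ℂ → ℝ) := by
  unfold frobSq frobInner
  exact Complex.continuous_re.comp
    ((continuous_id.matrix_conjTranspose.matrix_mul continuous_id).matrix_trace)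

theorem continuous_reTrace : Continuous (reTrace : Matrix n n ℂ → ℝ) :=
  Complex.continuous_re.comp continuous_id.matrix_trace

theorem Matrix.PosSemidef.reTrace_nonneg {A : Matrix n n ℂ} (hA : A.PosSemidef) :
    0 ≤ reTrace A :=
  (Complex.nonneg_iff.1 hA.trace_nonneg).1

/-- With `B = Cᴴ C`, cyclicity turns the pairing into the trace of `C A Cᴴ`. -/
theorem Matrix.PosSemidef.frobInner_nonneg {A B : Matrix n n ℂ} (hA : A.PosSemidef)
    (hB : B.PosSemidef) : 0 ≤ frobInner A B := by
  classical
  obtain ⟨C, rfl⟩ : ∃ C : Matrix n n ℂ, B = Cᴴ * C := by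
    open scoped MatrixOrder in
    exact CStarAlgebra.nonneg_iff_eq_star_mul_self.1 hB.nonneg
  rw [frobInner_of_isHermitian hA.1, ← Matrix.mul_assoc, trace_mul_comm, ← Matrix.mul_assoc]
  exact (hA.mul_mul_conjTranspose_same C).reTrace_nonneg

end frob

/-! ### Projection onto the positive semidefinite cone -/

section psdProj

variable {n : Type*} [Fintype n]

theorem IsPSDProj.eq_psdProj {A B : Matrix n n ℂ} (h : IsPSDProj A B) : psdProj A = B := by
  by_contra hne
  exact lt_asymm (h.2 _ (isPSDProj_psdProj A).1 hne)
    ((isPSDProj_psdProj A).2 B h.1 (Ne.symm hne))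

theorem psdProj_posSemidef (A : Matrix n n ℂ) : (psdProj A).PosSemidef :=
  (isPSDProj_psdProj A).1

/-- The variational inequality suffices: expand the square of `(A - B) - (C - B)`. It serves to
recognize explicit projections. -/
theorem psdProj_eq_of_inner_nonpos {A B : Matrix n n ℂ} (hB : B.PosSemidef)
    (h : ∀ C : Matrix n n ℂ, C.PosSemidef → frobInner (A - B) (C - B) ≤ 0) : psdProj A = B := by
  refine IsPSDProj.eq_psdProj ⟨hB, fun C hC hCB => ?_⟩
  have h1 : A - C = (A - B) - (C - B) := by abel
  have h2 := frobSq_pos (sub_ne_zero.2 hCB)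
  rw [h1, frobSq_sub (A - B)]
  linarith [h C hC]

/-- First-order optimality: compare the projection with nearby points of the segment towards `C`,
which stays in the cone. -/
theorem frobInner_sub_psdProj_nonpos (A : Matrix n n ℂ) {C : Matrix n n ℂ}
    (hC : C.PosSemidef) : frobInner (A - psdProj A) (C - psdProj A) ≤ 0 := by
  set B := psdProj A
  by_contra! hpos
  have key : ∀ s : ℝ, 0 < s → s ≤ 1 →
      2 * frobInner (A - B) (C - B) ≤ s * frobSq (C - B) := by
    intro s hs hs1
    have hW : (B + s • (C - B)).PosSemidef := by
      have : B + s • (C - B) = (1 - s) • B + s • C := by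
        rw [smul_sub, sub_smul, one_smul]; abel
      rw [this]
      exact ((psdProj_posSemidef A).smul (by linarith)).add (hC.smul hs.le)
    have hle : frobSq (A - B) ≤ frobSq (A - (B + s • (C - B))) := by
      by_cases heq : B + s • (C - B) = B
      · rw [heq]
      · exact ((isPSDProj_psdProj A).2 _ hW heq).le
    rw [← sub_sub, frobSq_sub _ (s • _), frobInner_smul_right, frobSq_smul] at hle
    nlinarith
  have h0 := frobSq_nonneg (C - B)
  rcases h0.eq_or_lt with h0 | h0
  · have := key 1 one_pos le_rfl
    rw [← h0] at this; linarith
  -- For this step length the right side of `key` is at most the inner product itself, so twice a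
  -- positive number is bounded by that number.
  · have h1 := key (min 1 (frobInner (A - B) (C - B) / frobSq (C - B)))
      (lt_min one_pos (div_pos hpos h0)) (min_le_left _ _)
    have h2 : min 1 (frobInner (A - B) (C - B) / frobSq (C - B)) * frobSq (C - B)
        ≤ frobInner (A - B) (C - B) :=
      (mul_le_mul_of_nonneg_right (min_le_right _ _) h0.le).trans_eq
        (div_mul_cancel₀ _ h0.ne')
    linarith

/-- Add the variational inequalities at the two projections, each tested against the other;
nonnegativity of the square in `h3` then replaces Cauchy–Schwarz. -/
theorem frobSq_psdProj_sub_le (A B : Matrix n n ℂ) :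
    frobSq (psdProj A - psdProj B) ≤ frobSq (A - B) := by
  have h1 := frobInner_sub_psdProj_nonpos A (psdProj_posSemidef B)
  have h2 := frobInner_sub_psdProj_nonpos B (psdProj_posSemidef A)
  have h3 := frobSq_nonneg ((A - B) - (psdProj A - psdProj B))
  rw [frobSq_sub] at h3
  simp only [frobSq, frobInner_sub_left, frobInner_sub_right] at *
  linarith [frobInner_comm (psdProj A) (psdProj B)]

theorem continuous_psdProj : Continuous (psdProj : Matrix n n ℂ → Matrix n n ℂ) := by
  refine continuous_iff_continuousAt.2 fun A => ?_
  have h0 : Filter.Tendsto (fun B => Real.sqrt (frobSq (B - A))) (nhds A) (nhds 0) := by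
    have : Continuous fun B => Real.sqrt (frobSq (B - A)) :=
      (continuous_frobSq.comp (continuous_id.sub continuous_const)).sqrt
    simpa [frobSq, frobInner] using this.tendsto A
  refine tendsto_pi_nhds.2 fun i => tendsto_pi_nhds.2 fun j => ?_
  rw [tendsto_iff_norm_sub_tendsto_zero]
  refine squeeze_zero (fun _ => norm_nonneg _) (fun B => ?_) h0
  refine Real.le_sqrt_of_sq_le ?_
  exact (norm_apply_sq_le_frobSq (psdProj B - psdProj A) i j).trans (frobSq_psdProj_sub_le B A)

theorem psdProj_eq_zero {A : Matrix n n ℂ} (hA : (-A).PosSemidef) : psdProj A = 0 := by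
  refine psdProj_eq_of_inner_nonpos PosSemidef.zero fun C hC => ?_
  have := hA.frobInner_nonneg hC
  simp only [sub_zero]
  simpa [frobInner] using this

variable [DecidableEq n]

theorem frobInner_diagonal (a : n → ℝ) (C : Matrix n n ℂ) :
    frobInner (diagonal fun i => (a i : ℂ)) C = ∑ i, a i * (C i i).re := by
  simp [frobInner, diagonal_conjTranspose, trace, diagonal_mul]

theorem psdProj_diagonal (a : n → ℝ) :
    psdProj (diagonal fun i => (a i : ℂ)) = diagonal fun i => ((max (a i) 0 : ℝ) : ℂ) := by
  refine psdProj_eq_of_inner_nonpos (PosSemidef.diagonal fun i => ?_) fun C hC => ?_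
  · simp
  · have : (diagonal fun i => (a i : ℂ)) - (diagonal fun i => ((max (a i) 0 : ℝ) : ℂ)) =
        diagonal fun i => ((a i - max (a i) 0 : ℝ) : ℂ) := by
      rw [diagonal_sub]; simp
    rw [this, frobInner_diagonal]
    refine Finset.sum_nonpos fun i _ => ?_
    have hc : 0 ≤ (C i i).re := (Complex.nonneg_iff.1 hC.diag_nonneg).1
    simp only [Matrix.sub_apply, diagonal_apply_eq, Complex.sub_re, Complex.ofReal_re]
    rcases le_total 0 (a i) with h | h
    · simp [h]
    · simp only [max_eq_right h, sub_zero]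
      exact mul_nonpos_of_nonpos_of_nonneg h hc

/-- Unitary conjugation preserves both the Frobenius norm and the cone, so it carries nearest points
to nearest points. -/
theorem psdProj_unitary_conj {U : Matrix n n ℂ} (hU : Uᴴ * U = 1) (A : Matrix n n ℂ) :
    psdProj (U * A * Uᴴ) = U * psdProj A * Uᴴ := by
  have hU' : U * Uᴴ = 1 := mul_eq_one_comm.1 hU
  have hsq : ∀ M : Matrix n n ℂ, frobSq (U * M * Uᴴ) = frobSq M := by
    intro M
    have h : (U * M * Uᴴ)ᴴ * (U * M * Uᴴ) = U * (Mᴴ * M * Uᴴ) := by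
      simp only [conjTranspose_mul, conjTranspose_conjTranspose, Matrix.mul_assoc]
      rw [← Matrix.mul_assoc Uᴴ U, hU, Matrix.one_mul]
    rw [frobSq, frobInner, h, trace_mul_comm, Matrix.mul_assoc, hU, Matrix.mul_one]; rfl
  refine IsPSDProj.eq_psdProj
    ⟨(psdProj_posSemidef A).mul_mul_conjTranspose_same U, fun C hC hne => ?_⟩
  have hC' : C = U * (Uᴴ * C * U) * Uᴴ := by
    simp only [Matrix.mul_assoc, hU', Matrix.mul_one]
    rw [← Matrix.mul_assoc, hU', Matrix.one_mul]
  rw [hC', ← Matrix.sub_mul, ← Matrix.mul_sub, hsq, ← Matrix.sub_mul, ← Matrix.mul_sub, hsq]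
  refine (isPSDProj_psdProj A).2 _ (hC.conjTranspose_mul_mul_same U) fun h => hne ?_
  rw [hC', h]

end psdProj

/-! ### Largest eigenvalue -/

section lamMax

variable {n : Type*} [Fintype n] [DecidableEq n] {A : Matrix n n ℂ} (hA : A.IsHermitian)

theorem eq_eigenvectorUnitary_mul : A = (hA.eigenvectorUnitary : Matrix n n ℂ) *
    diagonal (fun i => (hA.eigenvalues i : ℂ)) * (hA.eigenvectorUnitary : Matrix n n ℂ)ᴴ := by
  conv_lhs => rw [hA.spectral_theorem]
  rfl

theorem neg_add_smul_one_eq (c : ℝ) : -A + c • (1 : Matrix n n ℂ) =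
    (hA.eigenvectorUnitary : Matrix n n ℂ) *
    diagonal (fun i => ((c - hA.eigenvalues i : ℝ) : ℂ)) *
    (hA.eigenvectorUnitary : Matrix n n ℂ)ᴴ := by
  have h1 : (hA.eigenvectorUnitary : Matrix n n ℂ) * (hA.eigenvectorUnitary : Matrix n n ℂ)ᴴ = 1 :=
    Unitary.mul_star_self_of_mem hA.eigenvectorUnitary.2
  have h2 : diagonal (fun i => ((c - hA.eigenvalues i : ℝ) : ℂ)) =
      c • (1 : Matrix n n ℂ) - diagonal (fun i => (hA.eigenvalues i : ℂ)) := by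
    rw [← diagonal_one, ← diagonal_smul, diagonal_sub]
    simp
  rw [h2, Matrix.mul_sub, Matrix.sub_mul, ← eq_eigenvectorUnitary_mul, Matrix.mul_smul,
    Matrix.mul_one, Matrix.smul_mul, h1]
  abel

theorem posDef_neg_add_smul_one_iff (c : ℝ) :
    (-A + c • (1 : Matrix n n ℂ)).PosDef ↔ ∀ i, hA.eigenvalues i < c := by
  rw [neg_add_smul_one_eq hA]
  have := Unitary.isUnit_coe (U := hA.eigenvectorUnitary)
  rw [← star_eq_conjTranspose, this.posDef_star_right_conjugate_iff]
  simp

theorem posSemidef_neg_add_smul_one_iff (c : ℝ) :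
    (-A + c • (1 : Matrix n n ℂ)).PosSemidef ↔ ∀ i, hA.eigenvalues i ≤ c := by
  rw [neg_add_smul_one_eq hA]
  have := Unitary.isUnit_coe (U := hA.eigenvectorUnitary)
  rw [← star_eq_conjTranspose, this.posSemidef_star_right_conjugate_iff]
  simp

theorem eigenvalues_le_lamMax (i : n) : hA.eigenvalues i ≤ lamMax hA :=
  le_ciSup (Set.finite_range _).bddAbove i

theorem exists_eigenvalues_eq_lamMax [Nonempty n] : ∃ i, hA.eigenvalues i = lamMax hA :=
  exists_eq_ciSup_of_finite

end lamMax

/-! ### Bisection -/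

/-- Every midpoint averages a left endpoint `≥ a` and a right endpoint `≥ μ`, so the test need only
be correct from `(a + μ) / 2` on. In (ii) this matters because there may be no candidate at `a`. -/
theorem bisect_spec {above : ℝ → Prop} {a b μ : ℝ} (hμ : μ ∈ Set.Icc a b)
    (h : ∀ ν, (a + μ) / 2 ≤ ν → (above ν → ν ≤ μ) ∧ (¬ above ν → μ ≤ ν)) (t : ℕ) :
    a ≤ (bisect above a b t).1 ∧ μ ∈ Set.Icc (bisect above a b t).1 (bisect above a b t).2 ∧
      (bisect above a b t).2 - (bisect above a b t).1 = (b - a) / 2 ^ t := by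
  induction t with
  | zero => simpa [bisect] using hμ
  | succ t ih =>
    obtain ⟨h1, ⟨h2, h3⟩, h4⟩ := ih
    have hm := h (midpt (bisect above a b t)) (by unfold midpt; linarith)
    have hl : midpt (bisect above a b t) - (bisect above a b t).1 = (b - a) / 2 ^ (t + 1) ∧
        (bisect above a b t).2 - midpt (bisect above a b t) = (b - a) / 2 ^ (t + 1) := by
      rw [pow_succ, ← div_div, ← h4]
      unfold midpt
      constructor <;> ring
    have hnn : a ≤ midpt (bisect above a b t) := by unfold midpt; linarith
    simp only [bisect]
    split_ifs with hc
    · exact ⟨hnn, ⟨hm.1 hc, h3⟩, hl.2⟩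
    · exact ⟨h1, ⟨h2, hm.2 hc⟩, hl.1⟩

/-! ### Multipliers of the trace constraint -/

section multiplier

variable {n : Type*} [Fintype n] {f : Matrix n n ℂ → ℝ} {P : ℝ}

/-- A multiplier turns a maximizer of the Lagrangian into a maximizer of the constrained problem,
and every other constrained maximizer also maximizes the Lagrangian. -/
theorem argmaxOn_powerSet_eq {Q : Matrix n n ℂ} {μ : ℝ} (hQ : TraceCompl P Q μ)
    (h : argmaxOn (fun W => f W - μ * (reTrace W - P)) {W : Matrix n n ℂ | W.PosSemidef} = {Q}) :
    argmaxOn f (powerSet P) = {Q} := by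
  obtain ⟨h0, h1, h2⟩ := hQ
  have hm : Q ∈ argmaxOn (fun W => f W - μ * (reTrace W - P)) {W : Matrix n n ℂ | W.PosSemidef} :=
    h ▸ rfl
  have hle : ∀ W : Matrix n n ℂ, W.PosSemidef → f W - μ * (reTrace W - P) ≤ f Q := by
    intro W hW
    have h3 : f W - μ * (reTrace W - P) ≤ f Q - μ * (reTrace Q - P) := hm.2 hW
    linarith
  have hQm : Q ∈ powerSet P := ⟨hm.1, by linarith⟩
  refine Set.eq_singleton_iff_unique_mem.2 ⟨⟨hQm, fun W hW => ?_⟩, fun W hW => ?_⟩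
  · have := hle W hW.1
    have h4 := mul_nonneg h0 (sub_nonneg.2 hW.2)
    change f W ≤ f Q
    linarith
  · have h5 : W ∈ argmaxOn (fun W => f W - μ * (reTrace W - P))
        {W : Matrix n n ℂ | W.PosSemidef} := by
      refine ⟨hW.1.1, fun C hC => ?_⟩
      have h6 : f Q ≤ f W := hW.2 hQm
      have h4 := mul_nonneg h0 (sub_nonneg.2 hW.1.2)
      change f C - μ * (reTrace C - P) ≤ f W - μ * (reTrace W - P)
      linarith [hle C hC]
    rw [h] at h5
    exact h5

/-- A maximizer of the Lagrangian for two different multipliers has trace zero. -/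
theorem reTrace_eq_zero_of_mem_argmaxOn {X : Matrix n n ℂ} {μ ν : ℝ} (hne : μ ≠ ν)
    (hdiff : DifferentiableAt ℝ (fun s : ℝ => f (s • X)) 1)
    (hμ : X ∈ argmaxOn (fun W => f W - μ * (reTrace W - P)) {W : Matrix n n ℂ | W.PosSemidef})
    (hν : X ∈ argmaxOn (fun W => f W - ν * (reTrace W - P)) {W : Matrix n n ℂ | W.PosSemidef}) :
    reTrace X = 0 := by
  -- The ray `s • X` stays in the cone for `s > 0`, so `s = 1` is an interior maximum and the
  -- derivative of the Lagrangian along the ray vanishes there.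
  have key : ∀ c : ℝ,
      X ∈ argmaxOn (fun W => f W - c * (reTrace W - P)) {W : Matrix n n ℂ | W.PosSemidef} →
      deriv (fun s : ℝ => f (s • X)) 1 = c * reTrace X := by
    intro c hc
    have hd : HasDerivAt (fun s : ℝ => f (s • X) - c * (s * reTrace X - P))
        (deriv (fun s : ℝ => f (s • X)) 1 - c * (1 * reTrace X)) 1 :=
      hdiff.hasDerivAt.sub ((((hasDerivAt_id (1 : ℝ)).mul_const _).sub_const P).const_mul c)
    have hmax : IsLocalMax (fun s : ℝ => f (s • X) - c * (s * reTrace X - P)) 1 := by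
      filter_upwards [lt_mem_nhds (zero_lt_one (α := ℝ))] with s hs
      have := hc.2 (show s • X ∈ {W : Matrix n n ℂ | W.PosSemidef} from
        PosSemidef.smul hc.1 (le_of_lt hs))
      simpa [reTrace_smul] using this
    have := hmax.hasDerivAt_eq_zero hd
    linarith
  have h : (μ - ν) * reTrace X = 0 := by
    rw [sub_mul, ← key μ hμ, ← key ν hν, sub_self]
  exact (mul_eq_zero.1 h).resolve_left (sub_ne_zero.2 hne)

/-- The duality argument common to both problems. Emptiness off `S` excludes multipliers there;
`hsmall` provides either slack at `ν = 0` or a starting point for the intermediate value theorem. -/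
theorem exists_traceMultiplier (hP : 0 < P) {S : Set ℝ} (hS : IsUpperSet S)
    {X : ℝ → Matrix n n ℂ}
    (hX : ∀ ν ∈ S, argmaxOn (fun W => f W - ν * (reTrace W - P))
      {W : Matrix n n ℂ | W.PosSemidef} = {X ν})
    (hXc : ∀ ν ∉ S, argmaxOn (fun W => f W - ν * (reTrace W - P))
      {W : Matrix n n ℂ | W.PosSemidef} = ∅)
    (hdiff : ∀ W : Matrix n n ℂ, W.PosSemidef →
      DifferentiableAt ℝ (fun s : ℝ => f (s • W)) 1)
    (hcont : ContinuousOn (fun ν => reTrace (X ν)) S)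
    (hlarge : ∀ᶠ b in Filter.atTop, reTrace (X b) ≤ P)
    (hsmall : ∃ ν ∈ S, 0 ≤ ν ∧ (ν = 0 ∨ P ≤ reTrace (X ν))) :
    ∃ μ ∈ S, TraceCompl P (X μ) μ ∧ argmaxOn f (powerSet P) = {X μ} ∧
      (∀ ν, IsTraceMultiplier f P (X μ) ν ↔ ν = μ) ∧
      (∀ ν ∈ S, TraceCompl P (X ν) ν ↔ ν = μ) ∧
      ∀ ν ∈ S, 0 ≤ ν → (P < reTrace (X ν) → ν ≤ μ) ∧ (¬ P < reTrace (X ν) → μ ≤ ν) := by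
  have hmem : ∀ ν ∈ S, X ν ∈ argmaxOn (fun W => f W - ν * (reTrace W - P))
      {W : Matrix n n ℂ | W.PosSemidef} := fun ν hν => by rw [hX ν hν]; rfl
  have hle : ∀ ν ∈ S, ∀ c ∈ S, f (X c) - ν * (reTrace (X c) - P) ≤
      f (X ν) - ν * (reTrace (X ν) - P) := fun ν hν c hc => (hmem ν hν).2 (hmem c hc).1
  -- Adding the optimality inequalities of `X ν` and `X c` cancels `f` and leaves `(c - ν) (tr X c -
  -- tr X ν) ≤ 0`.
  have hanti : ∀ ν ∈ S, ∀ c ∈ S, ν < c → reTrace (X c) ≤ reTrace (X ν) := by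
    intro ν hν c hc h
    have h1 := hle ν hν c hc
    have h2 := hle c hc ν hν
    by_contra! h3
    nlinarith
  -- Equal traces would give `f (X ν) ≤ f (X c)`, so `X c` would maximize both Lagrangians and have
  -- trace zero.
  have hstrict : ∀ ν ∈ S, ∀ c ∈ S, ν < c → 0 < reTrace (X c) →
      reTrace (X c) < reTrace (X ν) := by
    intro ν hν c hc h hpos
    refine (hanti ν hν c hc h).lt_of_ne fun heq => hpos.ne' ?_
    have h2 := hle c hc ν hν
    rw [heq] at h2
    have h3 : X c ∈ argmaxOn (fun W => f W - ν * (reTrace W - P))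
        {W : Matrix n n ℂ | W.PosSemidef} := by
      refine ⟨(hmem c hc).1, fun W hW => ?_⟩
      have h4 : f W - ν * (reTrace W - P) ≤ f (X ν) - ν * (reTrace (X ν) - P) :=
        (hmem ν hν).2 hW
      change f W - ν * (reTrace W - P) ≤ f (X c) - ν * (reTrace (X c) - P)
      rw [heq]; linarith
    exact reTrace_eq_zero_of_mem_argmaxOn h.ne (hdiff _ (hmem c hc).1) h3 (hmem c hc)
  obtain ⟨μ, hμS, hμ⟩ : ∃ μ ∈ S, TraceCompl P (X μ) μ := by
    obtain ⟨ν, hν, h0, h⟩ := hsmall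
    by_cases hνP : P ≤ reTrace (X ν)
    · obtain ⟨b, hb, hνb⟩ := (hlarge.and (Filter.eventually_ge_atTop ν)).exists
      obtain ⟨μ, hμ, hμP⟩ := intermediate_value_Icc' hνb
        (hcont.mono fun c hc => hS hc.1 hν) ⟨hb, hνP⟩
      simp only at hμP
      exact ⟨μ, hS hμ.1 hν, h0.trans hμ.1, by linarith, by rw [hμP]; simp⟩
    · obtain rfl := h.resolve_right hνP
      exact ⟨0, hν, le_rfl, by linarith, by simp⟩
  have hbis : ∀ ν ∈ S, 0 ≤ ν →
      (P < reTrace (X ν) → ν ≤ μ) ∧ (¬ P < reTrace (X ν) → μ ≤ ν) := by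
    intro ν hν h0
    obtain ⟨g0, g1, g2⟩ := hμ
    refine ⟨fun h => ?_, fun h => ?_⟩
    · by_contra! hlt
      linarith [hanti μ hμS ν hν hlt]
    -- Here `0 ≤ ν < μ`, so the constraint is active at `μ`; strict decrease then puts the trace at
    -- `ν` above `P`.
    · by_contra! hlt
      have : reTrace (X μ) = P := by
        rcases mul_eq_zero.1 g2 with g | g <;> linarith
      linarith [hstrict ν hν μ hμS hlt (by linarith)]
  have huniq : ∀ ν ∈ S, TraceCompl P (X ν) ν ↔ ν = μ := by
    intro ν hν
    refine ⟨fun ⟨g0, g1, g2⟩ => ?_, fun h => h ▸ hμ⟩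
    refine le_antisymm ?_ ((hbis ν hν g0).2 (by linarith))
    by_contra! hlt
    have : reTrace (X ν) = P := by
      rcases mul_eq_zero.1 g2 with g | g
      · linarith [hμ.1]
      · linarith
    linarith [hstrict μ hμS ν hν hlt (by linarith), hμ.2.1]
  refine ⟨μ, hμS, hμ, argmaxOn_powerSet_eq hμ (hX μ hμS), fun ν => ⟨fun h => ?_, ?_⟩, huniq, hbis⟩
  · by_cases hν : ν ∈ S
    · have h1 := h.2
      rw [hX ν hν] at h1
      have h2 : X μ = X ν := h1
      exact (huniq ν hν).1 (h2 ▸ h.1)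
    · exact absurd h.2 (by rw [hXc ν hν]; exact Set.notMem_empty _)
  · rintro rfl
    exact ⟨hμ, hmem ν hμS⟩

end multiplier

/-! ### The quadratic problem -/

section quadratic

theorem frobInner_toBlocks₁₁ {m k : Type*} [Fintype m] [Fintype k] (Z : Matrix m m ℂ) (X : Matrix (m ⊕ k) (m ⊕ k) ℂ) :
    frobInner Z X.toBlocks₁₁ = frobInner (fromBlocks Z 0 0 0) X := by
  simp [frobInner, trace, mul_apply, toBlocks₁₁, Fintype.sum_sum_type]

variable {m k : Type*} [Fintype m] [Fintype k] [DecidableEq m] [DecidableEq k]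

/-- The linear terms combine to `-⟨G, W⟩`; completing the square moves the centre from `Xc` to `Xc -
G / (2τ)`. -/
theorem objX_sub_eq (τ : ℝ) (hτ : 0 < τ) (Xc : Matrix (m ⊕ k) (m ⊕ k) ℂ) (Z : Matrix m m ℂ)
    (P ν : ℝ) : ∃ c : ℝ, ∀ W, objX τ Xc Z W - ν * (reTrace W - P) =
      c - τ * frobSq ((Xc - (1 / (2 * τ)) •
        (ν • (1 : Matrix (m ⊕ k) (m ⊕ k) ℂ) + fromBlocks Z 0 0 0)) - W) := by
  set G := ν • (1 : Matrix (m ⊕ k) (m ⊕ k) ℂ) + fromBlocks Z 0 0 0 with hG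
  refine ⟨τ * frobSq (Xc - (1 / (2 * τ)) • G) - τ * frobSq Xc + ν * P, fun W => ?_⟩
  have h1 : ν * reTrace W + frobInner Z W.toBlocks₁₁ = frobInner G W := by
    rw [frobInner_toBlocks₁₁, hG, frobInner_add_left, frobInner_smul_left, frobInner_one]
  rw [objX, frobSq_sub W, frobSq_sub _ W, frobInner_sub_left, frobInner_smul_left,
    frobInner_comm W Xc, ← h1]
  field_simp
  ring

theorem argmaxOn_objX_sub {τ : ℝ} (hτ : 0 < τ) (Xc : Matrix (m ⊕ k) (m ⊕ k) ℂ)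
    (Z : Matrix m m ℂ) (P ν : ℝ) :
    argmaxOn (fun W => objX τ Xc Z W - ν * (reTrace W - P))
      {W : Matrix (m ⊕ k) (m ⊕ k) ℂ | W.PosSemidef} = {closedX τ Xc Z ν} := by
  obtain ⟨c, hc⟩ := objX_sub_eq τ hτ Xc Z P ν
  have hp := isPSDProj_psdProj (Xc - (1 / (2 * τ)) •
    (ν • (1 : Matrix (m ⊕ k) (m ⊕ k) ℂ) + fromBlocks Z 0 0 0))
  simp only [hc]
  change IsPSDProj _ (closedX τ Xc Z ν) at hp
  refine Set.eq_singleton_iff_unique_mem.2 ⟨⟨hp.1, fun W hW => ?_⟩, fun W hW => ?_⟩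
  · change c - _ ≤ c - _
    by_cases h : W = closedX τ Xc Z ν
    · rw [h]
    · have := hp.2 W hW h
      gcongr
  · by_contra hne
    have h1 := hp.2 W hW.1 hne
    have h2 := hW.2 hp.1
    change c - _ ≤ c - _ at h2
    nlinarith

theorem exists_multiplier_objX {P τ : ℝ} (hP : 0 < P) (hτ : 0 < τ) {Z : Matrix m m ℂ}
    (hZ : Z.IsHermitian) {Xc : Matrix (m ⊕ k) (m ⊕ k) ℂ} (hX : Xc.IsHermitian) :
    ∃ μ : ℝ,
      argmaxOn (objX τ Xc Z) (powerSet P) = {closedX τ Xc Z μ} ∧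
      (∀ ν : ℝ, IsTraceMultiplier (objX τ Xc Z) P (closedX τ Xc Z μ) ν ↔ ν = μ) ∧
      (∀ ν : ℝ, TraceCompl P (closedX τ Xc Z ν) ν ↔ ν = μ) ∧
      (∀ᶠ b : ℝ in Filter.atTop, reTrace (closedX τ Xc Z b) ≤ P) ∧
      (∀ b : ℝ, 0 ≤ b → reTrace (closedX τ Xc Z b) ≤ P → ∀ t : ℕ,
        let I := bisect (fun ν => P < reTrace (closedX τ Xc Z ν)) 0 b t
        μ ∈ Set.Icc I.1 I.2 ∧ I.2 - I.1 = b / 2 ^ t) := by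
  have hcont : Continuous fun ν => reTrace (closedX τ Xc Z ν) := by
    refine continuous_reTrace.comp (continuous_psdProj.comp ?_)
    fun_prop
  have hlarge : ∀ᶠ b : ℝ in Filter.atTop, reTrace (closedX τ Xc Z b) ≤ P := by
    have hA : (Xc - (1 / (2 * τ)) • fromBlocks Z 0 0 0).IsHermitian := by
      refine hX.sub ?_
      rw [IsHermitian, conjTranspose_smul, fromBlocks_conjTranspose, hZ.eq]
      simp
    -- The projected matrix is that of `hA` minus `b / (2τ)` times the identity, hence negative
    -- semidefinite from this `b` on.
    filter_upwards [Filter.eventually_ge_atTop (2 * τ * lamMax hA)] with b hb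
    have h0 : closedX τ Xc Z b = 0 := by
      refine psdProj_eq_zero ?_
      have h1 := (posSemidef_neg_add_smul_one_iff hA (b / (2 * τ))).2 fun i =>
        (eigenvalues_le_lamMax hA i).trans (by rw [le_div_iff₀ (by positivity)]; linarith)
      convert h1 using 1
      rw [smul_add, smul_smul, one_div_mul_eq_div]
      abel
    rw [h0, reTrace_zero]
    exact hP.le
  have hd : ∀ W : Matrix (m ⊕ k) (m ⊕ k) ℂ, W.PosSemidef →
      DifferentiableAt ℝ (fun s : ℝ => objX τ Xc Z (s • W)) 1 := by
    intro W _
    have : (fun s : ℝ => objX τ Xc Z (s • W)) = fun s : ℝ =>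
        -τ * (s ^ 2 * frobSq W - 2 * (s * frobInner W Xc) + frobSq Xc) -
          s * frobInner Z W.toBlocks₁₁ := by
      funext s
      rw [objX, frobSq_sub, frobSq_smul, frobInner_smul_left, frobInner_toBlocks₁₁,
        frobInner_smul_right, frobInner_toBlocks₁₁]
    rw [this]
    fun_prop
  obtain ⟨μ, -, hμ, h1, h2, h3, h4⟩ := exists_traceMultiplier hP isUpperSet_univ
    (fun ν _ => argmaxOn_objX_sub hτ Xc Z P ν) (fun ν hν => absurd (Set.mem_univ ν) hν) hd
    hcont.continuousOn hlarge ⟨0, Set.mem_univ _, le_rfl, Or.inl rfl⟩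
  refine ⟨μ, h1, h2, fun ν => h3 ν (Set.mem_univ ν), hlarge, fun b hb0 hb t => ?_⟩
  have := bisect_spec (above := fun ν => P < reTrace (closedX τ Xc Z ν)) (a := 0) (b := b) (μ := μ)
    ⟨hμ.1, (h4 b (Set.mem_univ b) hb0).2 hb.not_gt⟩
    (fun ν hν => h4 ν (Set.mem_univ ν) (by linarith [hμ.1])) t
  exact ⟨this.2.1, by simpa using this.2.2⟩

end quadratic

/-! ### Bounds on the log-determinant -/

section logdet

variable {n : Type*} [Fintype n] [DecidableEq n]

theorem re_det_eq_prod_eigenvalues {A : Matrix n n ℂ} (hA : A.IsHermitian) :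
    A.det.re = ∏ i, hA.eigenvalues i := by
  rw [hA.det_eq_prod_eigenvalues]
  exact_mod_cast Complex.ofReal_re (∏ i, hA.eigenvalues i)

theorem reTrace_eq_sum_eigenvalues {A : Matrix n n ℂ} (hA : A.IsHermitian) :
    reTrace A = ∑ i, hA.eigenvalues i := by
  rw [reTrace, hA.trace_eq_sum_eigenvalues]
  exact_mod_cast Complex.ofReal_re (∑ i, hA.eigenvalues i)

theorem Matrix.PosDef.re_det_pos {A : Matrix n n ℂ} (hA : A.PosDef) : 0 < A.det.re :=
  (Complex.pos_iff.1 hA.det_pos).1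

/-- Sum `log x ≤ x - 1` over the eigenvalues; equality throughout would force all of them to be `1`.
The trace is written through diagonal entries so that the bound later separates. -/
theorem log_det_lt_of_ne_one {M : Matrix n n ℂ} (hM : M.PosDef) (hne : M ≠ 1) :
    Real.log M.det.re < ∑ i, ((M i i).re - 1) := by
  have htr : ∑ i, ((M i i).re - 1) = ∑ i, (hM.1.eigenvalues i - 1) := by
    have := reTrace_eq_sum_eigenvalues hM.1
    simp only [reTrace, trace, Complex.re_sum, diag] at this
    rw [Finset.sum_sub_distrib, Finset.sum_sub_distrib, this]
  rw [htr, re_det_eq_prod_eigenvalues hM.1, Real.log_prod fun i _ => (hM.eigenvalues_pos i).ne']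
  obtain ⟨i, hi⟩ : ∃ i, hM.1.eigenvalues i ≠ 1 := by
    by_contra! h
    refine hne ?_
    rw [eq_eigenvectorUnitary_mul hM.1]
    simp only [h, Complex.ofReal_one, diagonal_one, Matrix.mul_one]
    exact Unitary.mul_star_self_of_mem hM.1.eigenvectorUnitary.2
  exact Finset.sum_lt_sum (fun j _ => Real.log_le_sub_one_of_pos (hM.eigenvalues_pos j))
    ⟨i, Finset.mem_univ i, Real.log_lt_sub_one_of_pos (hM.eigenvalues_pos i) hi⟩

/-- The strict tangent bound for `log det` at `diagonal d`, obtained from the identity case by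
congruence with `E = diagonal d^{-1/2}`. -/
theorem log_det_lt_of_ne_diagonal {M : Matrix n n ℂ} (hM : M.PosDef) {d : n → ℝ}
    (hd : ∀ i, 0 < d i) (hne : M ≠ diagonal fun i => (d i : ℂ)) :
    Real.log M.det.re < ∑ i, (Real.log (d i) + ((M i i).re / d i - 1)) := by
  set E : Matrix n n ℂ := diagonal fun i => (((Real.sqrt (d i))⁻¹ : ℝ) : ℂ) with hE
  set F : Matrix n n ℂ := diagonal fun i => ((Real.sqrt (d i) : ℝ) : ℂ) with hF
  have hs : ∀ i, Real.sqrt (d i) ≠ 0 := fun i => (Real.sqrt_pos.2 (hd i)).ne'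
  have hFE : F * E = 1 := by
    rw [hE, hF, diagonal_mul_diagonal, ← diagonal_one]
    congr 1; funext i
    rw [← Complex.ofReal_mul, mul_inv_cancel₀ (hs i), Complex.ofReal_one]
  have hEF : E * F = 1 := mul_eq_one_comm.1 hFE
  have hFF : F * F = diagonal fun i => (d i : ℂ) := by
    rw [hF, diagonal_mul_diagonal]
    congr 1; funext i
    rw [← Complex.ofReal_mul, Real.mul_self_sqrt (hd i).le]
  have hEH : star E = E := by
    rw [hE, star_eq_conjTranspose, diagonal_conjTranspose]
    congr 1; funext i
    simp
  have hEu : IsUnit E := IsUnit.of_mul_eq_one F hEF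
  have hN : (E * M * E).PosDef := by
    have := hEu.posDef_star_left_conjugate_iff.2 hM
    rwa [hEH] at this
  have hN1 : E * M * E ≠ 1 := by
    intro h
    apply hne
    calc M = F * E * M * (E * F) := by rw [hFE, hEF]; simp
      _ = F * (E * M * E) * F := by simp only [Matrix.mul_assoc]
      _ = _ := by rw [h, Matrix.mul_one, hFF]
  have hdet : (E * M * E).det.re = M.det.re * ∏ i, (d i)⁻¹ := by
    have : (E * M * E).det = ((∏ i, (d i)⁻¹ : ℝ) : ℂ) * M.det := by
      rw [det_mul, det_mul, mul_right_comm, ← det_mul]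
      congr 1
      rw [hE, diagonal_mul_diagonal, det_diagonal, Complex.ofReal_prod]
      refine Finset.prod_congr rfl fun i _ => ?_
      rw [← Complex.ofReal_mul, ← mul_inv, Real.mul_self_sqrt (hd i).le]
    rw [this, Complex.re_ofReal_mul, mul_comm]
  have hdiag : ∀ i, ((E * M * E) i i).re = (M i i).re / d i := by
    intro i
    rw [hE, mul_diagonal, diagonal_mul, Complex.re_mul_ofReal, Complex.re_ofReal_mul]
    field_simp
    rw [Real.sq_sqrt (hd i).le]
  have h := log_det_lt_of_ne_one hN hN1
  simp only [hdiag] at h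
  rw [hdet, Real.log_mul hM.re_det_pos.ne'
    (Finset.prod_pos fun i _ => inv_pos.2 (hd i)).ne',
    Real.log_prod fun i _ => (inv_pos.2 (hd i)).ne'] at h
  simp only [Real.log_inv, Finset.sum_neg_distrib] at h
  rw [Finset.sum_add_distrib]
  linarith

/-- `W * D` need not be Hermitian; writing `W = Cᴴ C`, the determinant equals that of the positive
definite `1 + C D Cᴴ`. -/
theorem re_det_one_add_mul_pos {W D : Matrix n n ℂ} (hW : W.PosSemidef) (hD : D.PosDef) :
    0 < (1 + W * D).det.re := by
  obtain ⟨C, rfl⟩ : ∃ C : Matrix n n ℂ, W = Cᴴ * C := by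
    open scoped MatrixOrder in
    exact CStarAlgebra.nonneg_iff_eq_star_mul_self.1 hW.nonneg
  rw [Matrix.mul_assoc, det_one_add_mul_comm]
  exact (PosDef.one.add_posSemidef
    (hD.posSemidef.mul_mul_conjTranspose_same C)).re_det_pos

end logdet

/-! ### Generalized eigenvalue decompositions -/

section genEig

variable {n : Type*} [Fintype n] [DecidableEq n] {D B V : Matrix n n ℂ} {σ : n → ℝ}

theorem IsGenEigDecomp.isUnit (h : IsGenEigDecomp D B V σ) : IsUnit V :=
  IsUnit.of_mul_eq_one (Vᴴ * B) (mul_eq_one_comm.1 h.2)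

/-- The normalization makes `B` congruent to the identity. Hence decompositions of the shifted pair
exist only for `ν` above the spectrum of `Z`. -/
theorem IsGenEigDecomp.posDef (h : IsGenEigDecomp D B V σ) : B.PosDef := by
  rw [← h.isUnit.posDef_star_left_conjugate_iff, star_eq_conjTranspose, h.2]
  exact PosDef.one

theorem IsGenEigDecomp.conj_eq_diagonal (h : IsGenEigDecomp D B V σ) :
    Vᴴ * D * V = diagonal fun i => (σ i : ℂ) := by
  rw [Matrix.mul_assoc, h.1, Matrix.mul_assoc B, ← Matrix.mul_assoc, ← Matrix.mul_assoc, h.2,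
    Matrix.one_mul]

theorem IsGenEigDecomp.pos (h : IsGenEigDecomp D B V σ) (hD : D.PosDef) (i : n) : 0 < σ i := by
  have := h.isUnit.posDef_star_left_conjugate_iff.2 hD
  rw [star_eq_conjTranspose, h.conj_eq_diagonal, posDef_diagonal_iff] at this
  exact_mod_cast this i

theorem IsGenEigDecomp.inv_right (h : IsGenEigDecomp D B V σ) : B⁻¹ = V * Vᴴ := by
  refine inv_eq_left_inv ?_
  rw [Matrix.mul_assoc, mul_eq_one_comm, h.2]

theorem inv_diagonal_ofReal (hσ : ∀ i, σ i ≠ 0) :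
    (diagonal fun i => (σ i : ℂ))⁻¹ = diagonal fun i => (((σ i)⁻¹ : ℝ) : ℂ) := by
  refine inv_eq_left_inv ?_
  rw [diagonal_mul_diagonal, ← diagonal_one]
  congr 1; funext i
  rw [← Complex.ofReal_mul, inv_mul_cancel₀ (hσ i), Complex.ofReal_one]

theorem diagonal_inv_mul (hσ : ∀ i, σ i ≠ 0) :
    (diagonal fun i => (((σ i)⁻¹ : ℝ) : ℂ)) * (diagonal fun i => (σ i : ℂ)) = 1 := by
  rw [diagonal_mul_diagonal, ← diagonal_one]
  congr 1; funext i
  rw [← Complex.ofReal_mul, inv_mul_cancel₀ (hσ i), Complex.ofReal_one]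

theorem IsGenEigDecomp.inv_left (h : IsGenEigDecomp D B V σ) (hD : D.PosDef) :
    D⁻¹ = V * (diagonal fun i => (((σ i)⁻¹ : ℝ) : ℂ)) * Vᴴ := by
  refine inv_eq_left_inv ?_
  rw [Matrix.mul_assoc, Matrix.mul_assoc, mul_eq_one_comm, Matrix.mul_assoc, h.conj_eq_diagonal,
    diagonal_inv_mul fun i => (h.pos hD i).ne']

theorem smul_one_sub_inv_diagonal (ρ : ℝ) (hσ : ∀ i, σ i ≠ 0) :
    ρ • (1 : Matrix n n ℂ) - (diagonal fun i => (σ i : ℂ))⁻¹ =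
      diagonal fun i => ((ρ - (σ i)⁻¹ : ℝ) : ℂ) := by
  rw [inv_diagonal_ofReal hσ, ← diagonal_one, ← diagonal_smul, diagonal_sub]
  simp

theorem waterfill_eq (ρ : ℝ) (V : Matrix n n ℂ) (hσ : ∀ i, σ i ≠ 0) :
    waterfill ρ V σ = V * (diagonal fun i => ((max (ρ - (σ i)⁻¹) 0 : ℝ) : ℂ)) * Vᴴ := by
  rw [waterfill, smul_one_sub_inv_diagonal ρ hσ, psdProj_diagonal]

theorem waterfill_posSemidef (ρ : ℝ) (V : Matrix n n ℂ) (σ : n → ℝ) :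
    (waterfill ρ V σ).PosSemidef :=
  (psdProj_posSemidef _).mul_mul_conjTranspose_same V

/-- `ρ B⁻¹ - D⁻¹` is the waterfilling formula without clipping, and clipping adds a semidefinite
matrix. This forces the trace to blow up as `B` becomes singular. -/
theorem IsGenEigDecomp.le_reTrace_waterfill (h : IsGenEigDecomp D B V σ) (hD : D.PosDef)
    (ρ : ℝ) : ρ * reTrace B⁻¹ - reTrace D⁻¹ ≤ reTrace (waterfill ρ V σ) := by
  have hσ : ∀ i, σ i ≠ 0 := fun i => (h.pos hD i).ne'
  have h1 : waterfill ρ V σ - (ρ • B⁻¹ - D⁻¹) =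
      V * (diagonal fun i => ((max (ρ - (σ i)⁻¹) 0 - (ρ - (σ i)⁻¹) : ℝ) : ℂ)) * Vᴴ := by
    have h2 : ρ • B⁻¹ - D⁻¹ = V * (diagonal fun i => ((ρ - (σ i)⁻¹ : ℝ) : ℂ)) * Vᴴ := by
      rw [← smul_one_sub_inv_diagonal ρ hσ, inv_diagonal_ofReal hσ, Matrix.mul_sub,
        Matrix.sub_mul, ← h.inv_left hD, h.inv_right, Matrix.mul_smul, Matrix.smul_mul,
        Matrix.mul_one]
    rw [waterfill_eq ρ V hσ, h2, ← Matrix.sub_mul, ← Matrix.mul_sub, diagonal_sub]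
    simp only [Complex.ofReal_sub]
  have h3 : (waterfill ρ V σ - (ρ • B⁻¹ - D⁻¹)).PosSemidef := by
    rw [h1]
    refine PosSemidef.mul_mul_conjTranspose_same (PosSemidef.diagonal fun i => ?_) V
    rw [Pi.zero_apply, Complex.zero_le_real]
    linarith [le_max_left (ρ - (σ i)⁻¹) 0]
  have h4 := h3.reTrace_nonneg
  have h5 : reTrace (waterfill ρ V σ - (ρ • B⁻¹ - D⁻¹)) =
      reTrace (waterfill ρ V σ) - (ρ * reTrace B⁻¹ - reTrace D⁻¹) := by
    simp [reTrace]
  linarith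

/-- Congruence by `V` turns `B - ρ D` into the diagonal matrix with entries `1 - ρ σ i`, so `ρ ≤ (σ
i)⁻¹` and everything is clipped. -/
theorem IsGenEigDecomp.waterfill_eq_zero (h : IsGenEigDecomp D B V σ) (hD : D.PosDef) {ρ : ℝ}
    (hB : (B - ρ • D).PosSemidef) : waterfill ρ V σ = 0 := by
  have hσ := h.pos hD
  have h1 := hB.conjTranspose_mul_mul_same V
  rw [Matrix.mul_sub, Matrix.sub_mul, h.2, Matrix.mul_smul, Matrix.smul_mul,
    h.conj_eq_diagonal] at h1
  have h2 : ∀ i, ρ - (σ i)⁻¹ ≤ 0 := by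
    intro i
    have := (Complex.nonneg_iff.1 (h1.diag_nonneg (i := i))).1
    simp only [Matrix.sub_apply, Matrix.smul_apply, one_apply_eq, diagonal_apply_eq,
      Complex.sub_re, Complex.one_re, Complex.smul_re, Complex.ofReal_re, smul_eq_mul] at this
    rw [sub_nonpos, ← one_div, le_div_iff₀ (hσ i)]
    linarith
  rw [waterfill_eq ρ V fun i => (hσ i).ne']
  simp [max_eq_right (h2 _)]

end genEig

/-! ### The log-determinant problem -/

section logDetProblem

variable {m : Type*} [Fintype m] [DecidableEq m] {D Z V : Matrix m m ℂ} {σ : m → ℝ} {ν ρ P : ℝ}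

/-- The two linear terms merge into `-tr N` since `Vᴴ (-Z + ν I) V = I`, and the determinant splits
off the constant factor `∏ σ i`. -/
theorem objY_sub_conj_eq (h : IsGenEigDecomp D (-Z + ν • (1 : Matrix m m ℂ)) V σ) (hD : D.PosDef)
    (hZ : Z.IsHermitian) {N : Matrix m m ℂ} (hN : N.PosSemidef) :
    objY ρ D Z (V * N * Vᴴ) - ν * (reTrace (V * N * Vᴴ) - P) =
      ρ * Real.log ((diagonal fun i => (((σ i)⁻¹ : ℝ) : ℂ)) + N).det.re - reTrace N +
        (ρ * ∑ i, Real.log (σ i) + ν * P) := by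
  have hσ := h.pos hD
  have h1 : (1 + V * N * Vᴴ * D).det.re =
      ((diagonal fun i => (((σ i)⁻¹ : ℝ) : ℂ)) + N).det.re * ∏ i, σ i := by
    have h2 : (1 + N * (Vᴴ * D * V)) = ((diagonal fun i => (((σ i)⁻¹ : ℝ) : ℂ)) + N) *
        diagonal fun i => (σ i : ℂ) := by
      rw [h.conj_eq_diagonal, Matrix.add_mul, diagonal_inv_mul fun i => (hσ i).ne']
    have h3 : (1 + V * N * Vᴴ * D).det = (1 + N * (Vᴴ * D * V)).det := by
      rw [show V * N * Vᴴ * D = V * (N * Vᴴ * D) by simp only [Matrix.mul_assoc],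
        det_one_add_mul_comm]
      simp only [Matrix.mul_assoc]
    rw [h3, h2, det_mul, det_diagonal, ← Complex.ofReal_prod, Complex.re_mul_ofReal]
  have h4 : frobInner Z (V * N * Vᴴ) - ν * reTrace (V * N * Vᴴ) = - reTrace N := by
    have h5 : reTrace N = ((-Z + ν • (1 : Matrix m m ℂ)) * (V * N * Vᴴ)).trace.re := by
      rw [reTrace, show (-Z + ν • (1 : Matrix m m ℂ)) * (V * N * Vᴴ) =
        ((-Z + ν • (1 : Matrix m m ℂ)) * V * N) * Vᴴ by simp only [Matrix.mul_assoc],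
        trace_mul_comm]
      simp only [← Matrix.mul_assoc]
      rw [h.2, Matrix.one_mul]
    rw [h5, frobInner_of_isHermitian hZ, Matrix.add_mul, Matrix.neg_mul, Matrix.smul_mul,
      Matrix.one_mul, trace_add, trace_neg, trace_smul, reTrace]
    simp
    ring
  have hpd : ((diagonal fun i => (((σ i)⁻¹ : ℝ) : ℂ)) + N).PosDef :=
    (PosDef.diagonal fun i => by
      rw [Complex.zero_lt_real]; exact inv_pos.2 (hσ i)).add_posSemidef hN
  rw [objY, h1, Real.log_mul hpd.re_det_pos.ne' (Finset.prod_pos fun i _ => hσ i).ne',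
    Real.log_prod fun i _ => (hσ i).ne']
  linarith

/-- Use the tangent bound at the candidate, whose levels are `d i = max ρ (σ i)⁻¹`. What remains is
a scalar inequality in each diagonal entry of `N`. -/
theorem log_det_sub_reTrace_lt (hρ : 0 < ρ) (hσ : ∀ i, 0 < σ i) {N : Matrix m m ℂ}
    (hN : N.PosSemidef) (hne : N ≠ diagonal fun i => ((max (ρ - (σ i)⁻¹) 0 : ℝ) : ℂ)) :
    ρ * Real.log ((diagonal fun i => (((σ i)⁻¹ : ℝ) : ℂ)) + N).det.re - reTrace N <
      ρ * Real.log ((diagonal fun i => (((σ i)⁻¹ : ℝ) : ℂ)) +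
        diagonal fun i => ((max (ρ - (σ i)⁻¹) 0 : ℝ) : ℂ)).det.re -
        reTrace (diagonal fun i => ((max (ρ - (σ i)⁻¹) 0 : ℝ) : ℂ)) := by
  set d : m → ℝ := fun i => (σ i)⁻¹ + max (ρ - (σ i)⁻¹) 0 with hd
  have hinv : ∀ i, 0 < (σ i)⁻¹ := fun i => inv_pos.2 (hσ i)
  have hdpos : ∀ i, 0 < d i := fun i =>
    add_pos_of_pos_of_nonneg (hinv i) (le_max_right _ _)
  have hsum : ((diagonal fun i => (((σ i)⁻¹ : ℝ) : ℂ)) +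
      diagonal fun i => ((max (ρ - (σ i)⁻¹) 0 : ℝ) : ℂ)) = diagonal fun i => (d i : ℂ) := by
    rw [diagonal_add]
    simp only [hd, Complex.ofReal_add]
  have hpd : ((diagonal fun i => (((σ i)⁻¹ : ℝ) : ℂ)) + N).PosDef :=
    (PosDef.diagonal fun i => by
      rw [Complex.zero_lt_real]; exact hinv i).add_posSemidef hN
  have hne' : (diagonal fun i => (((σ i)⁻¹ : ℝ) : ℂ)) + N ≠ diagonal fun i => (d i : ℂ) := by
    rw [← hsum]
    exact fun h => hne (add_left_cancel h)
  have h1 := log_det_lt_of_ne_diagonal hpd hdpos hne'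
  have h2 : (diagonal fun i => (d i : ℂ)).det.re = ∏ i, d i := by
    rw [det_diagonal, ← Complex.ofReal_prod, Complex.ofReal_re]
  rw [hsum, h2, Real.log_prod fun i _ => (hdpos i).ne']
  have h3 := mul_lt_mul_of_pos_left h1 hρ
  refine (sub_lt_sub_right h3 _).trans_le ?_
  simp only [reTrace, trace, Complex.re_sum, diag, diagonal_apply_eq, Complex.ofReal_re,
    Finset.mul_sum]
  rw [← Finset.sum_sub_distrib, ← Finset.sum_sub_distrib]
  refine Finset.sum_le_sum fun i _ => ?_
  have hx : 0 ≤ (N i i).re := (Complex.nonneg_iff.1 hN.diag_nonneg).1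
  simp only [Matrix.add_apply, diagonal_apply_eq, Complex.add_re, Complex.ofReal_re]
  have hi := hinv i
  suffices ρ * (((σ i)⁻¹ + (N i i).re) / d i - 1) - (N i i).re ≤ - max (ρ - (σ i)⁻¹) 0 by
    linarith
  -- Above the threshold `d i = ρ` and equality holds; below it the left side is `(ρ σ i - 1)` times
  -- the entry of `N`, hence nonpositive.
  rcases le_total 0 (ρ - (σ i)⁻¹) with hc | hc
  · have : d i = ρ := by simp only [hd, max_eq_left hc]; ring
    rw [this, max_eq_left hc]
    field_simp
    linarith
  · have : d i = (σ i)⁻¹ := by simp only [hd, max_eq_right hc]; ring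
    rw [this, max_eq_right hc, add_div, div_self hi.ne', div_inv_eq_mul]
    have h4 : ρ * σ i ≤ 1 := by
      have := mul_le_mul_of_nonneg_right (sub_nonpos.1 hc) (hσ i).le
      rwa [inv_mul_cancel₀ (hσ i).ne'] at this
    nlinarith

theorem argmaxOn_objY_sub (h : IsGenEigDecomp D (-Z + ν • (1 : Matrix m m ℂ)) V σ)
    (hD : D.PosDef) (hZ : Z.IsHermitian) (hρ : 0 < ρ) :
    argmaxOn (fun W => objY ρ D Z W - ν * (reTrace W - P))
      {W : Matrix m m ℂ | W.PosSemidef} = {waterfill ρ V σ} := by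
  have hσ := h.pos hD
  have hV : V * (Vᴴ * (-Z + ν • (1 : Matrix m m ℂ))) = 1 := mul_eq_one_comm.1 h.2
  have hVH : (-Z + ν • (1 : Matrix m m ℂ)) * V * Vᴴ = 1 := by
    rw [mul_eq_one_comm, ← Matrix.mul_assoc, h.2]
  have hB : (-Z + ν • (1 : Matrix m m ℂ))ᴴ = -Z + ν • (1 : Matrix m m ℂ) := h.posDef.1
  -- Since `V⁻¹ = Vᴴ (-Z + ν I)`, every semidefinite `W` is `V N Vᴴ` with `N` semidefinite.
  have hconj : ∀ W : Matrix m m ℂ, W.PosSemidef → ∃ N : Matrix m m ℂ, N.PosSemidef ∧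
      W = V * N * Vᴴ := by
    intro W hW
    refine ⟨_, hW.conjTranspose_mul_mul_same ((-Z + ν • (1 : Matrix m m ℂ)) * V), ?_⟩
    rw [conjTranspose_mul, hB]
    calc W = (V * (Vᴴ * (-Z + ν • (1 : Matrix m m ℂ)))) * W *
          ((-Z + ν • (1 : Matrix m m ℂ)) * V * Vᴴ) := by rw [hV, hVH]; simp
      _ = _ := by simp only [Matrix.mul_assoc]
  have hlt : ∀ W : Matrix m m ℂ, W.PosSemidef → W ≠ waterfill ρ V σ →
      objY ρ D Z W - ν * (reTrace W - P) <
        objY ρ D Z (waterfill ρ V σ) - ν * (reTrace (waterfill ρ V σ) - P) := by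
    intro W hW hne
    obtain ⟨N, hN, rfl⟩ := hconj W hW
    rw [waterfill_eq ρ V fun i => (hσ i).ne'] at hne ⊢
    rw [objY_sub_conj_eq h hD hZ hN, objY_sub_conj_eq h hD hZ
      (PosSemidef.diagonal fun i => by
        rw [Pi.zero_apply, Complex.zero_le_real]; exact le_max_right _ _)]
    have := log_det_sub_reTrace_lt hρ hσ hN fun h => hne (by rw [h])
    linarith
  refine Set.eq_singleton_iff_unique_mem.2
    ⟨⟨waterfill_posSemidef ρ V σ, fun W hW => ?_⟩, fun W hW => ?_⟩
  · by_cases hne : W = waterfill ρ V σ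
    · exact hne ▸ le_refl (objY ρ D Z W - ν * (reTrace W - P))
    · exact (hlt W hW hne).le
  · by_contra hne
    exact (hlt W hW.1 hne).not_ge (hW.2 (waterfill_posSemidef ρ V σ))

/-- Some eigenvalue of `Z` is at least `ν`. Along `s v vᴴ`, with `v` a unit eigenvector for it, the
linear term is nonnegative and the logarithm tends to infinity. -/
theorem argmaxOn_objY_sub_eq_empty (hZ : Z.IsHermitian) (hD : D.PosDef) (hρ : 0 < ρ)
    (h : ¬ (-Z + ν • (1 : Matrix m m ℂ)).PosDef) :
    argmaxOn (fun W => objY ρ D Z W - ν * (reTrace W - P))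
      {W : Matrix m m ℂ | W.PosSemidef} = ∅ := by
  rw [posDef_neg_add_smul_one_iff hZ] at h
  push Not at h
  obtain ⟨i, hi⟩ := h
  refine Set.eq_empty_iff_forall_notMem.2 fun Q hQ => ?_
  set v : m → ℂ := (hZ.eigenvectorBasis i).ofLp with hv
  have hZv : Z *ᵥ v = hZ.eigenvalues i • v := hZ.mulVec_eigenvectorBasis i
  have hvv : v ⬝ᵥ star v = 1 := by
    have := hZ.eigenvectorBasis.inner_eq_one i
    rwa [EuclideanSpace.inner_eq_star_dotProduct] at this
  have hv0 : v ≠ 0 := by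
    intro h0
    rw [h0] at hvv
    simp at hvv
  have hq : 0 < (star v ⬝ᵥ (D *ᵥ v)).re := hD.re_dotProduct_pos hv0
  set q := (star v ⬝ᵥ (D *ᵥ v)).re
  have hval : ∀ s : ℝ, objY ρ D Z (s • vecMulVec v (star v)) -
      ν * (reTrace (s • vecMulVec v (star v)) - P) =
      ρ * Real.log (1 + s * q) + s * (hZ.eigenvalues i - ν) + ν * P := by
    intro s
    have h1 : (1 + s • vecMulVec v (star v) * D).det.re = 1 + s * q := by
      rw [Matrix.smul_mul, vecMulVec_mul, ← smul_vecMulVec, vecMulVec_eq Unit,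
        det_one_add_replicateCol_mul_replicateRow, dotProduct_smul, ← dotProduct_mulVec]
      simp [q]
    have h2 : reTrace (s • vecMulVec v (star v)) = s := by
      rw [reTrace_smul, reTrace, trace_vecMulVec, hvv]; simp
    have h3 : frobInner Z (s • vecMulVec v (star v)) = s * hZ.eigenvalues i := by
      rw [frobInner_smul_right, frobInner_of_isHermitian hZ, mul_vecMulVec, hZv, trace_vecMulVec,
        smul_dotProduct, hvv]
      simp
    rw [objY, h1, h2, h3]
    ring
  have hlim : Filter.Tendsto (fun s : ℝ => ρ * Real.log (1 + s * q) + ν * P)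
      Filter.atTop Filter.atTop :=
    Filter.tendsto_atTop_add_const_right _ _ ((Real.tendsto_log_atTop.comp
      (Filter.tendsto_atTop_add_const_left _ _
        (Filter.tendsto_id.atTop_mul_const hq))).const_mul_atTop hρ)
  obtain ⟨s, hs0, hs⟩ := ((Filter.eventually_ge_atTop 0).and
    (hlim.eventually_gt_atTop (objY ρ D Z Q - ν * (reTrace Q - P)))).exists
  have h4 : objY ρ D Z (s • vecMulVec v (star v)) -
      ν * (reTrace (s • vecMulVec v (star v)) - P) ≤ objY ρ D Z Q - ν * (reTrace Q - P) :=
    hQ.2 (PosSemidef.smul (posSemidef_vecMulVec_self_star v) hs0)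
  rw [hval] at h4
  nlinarith [mul_nonneg hs0 (sub_nonneg.2 hi)]

theorem differentiableAt_objY_smul (hD : D.PosDef) {W : Matrix m m ℂ} (hW : W.PosSemidef) :
    DifferentiableAt ℝ (fun s : ℝ => objY ρ D Z (s • W)) 1 := by
  have h0 : (1 + (1 : ℝ) • W * D).det.re ≠ 0 := by
    rw [one_smul]; exact (re_det_one_add_mul_pos hW hD).ne'
  have hdet : DifferentiableAt ℝ (fun s : ℝ => (1 + s • W * D).det) 1 := by
    simp only [det_apply, Matrix.smul_mul, Matrix.add_apply, Matrix.smul_apply]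
    fun_prop
  have hre : DifferentiableAt ℝ (fun s : ℝ => (1 + s • W * D).det.re) 1 :=
    Complex.reCLM.differentiableAt.comp 1 hdet
  simp only [objY, frobInner_smul_right]
  exact ((hre.log h0).const_mul ρ).add (by fun_prop)

end logDetProblem

/-! ### Explicit square roots of `-Z + ν I` and existence of decompositions -/

section shift

variable {m : Type*} [Fintype m] [DecidableEq m] {D Z : Matrix m m ℂ} (hZ : Z.IsHermitian)

/-- `U diag(g (ν - zᵢ)) Uᴴ`, where `Z = U diag(z) Uᴴ`. -/
noncomputable def shiftFun (g : ℝ → ℝ) (ν : ℝ) : Matrix m m ℂ :=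
  (hZ.eigenvectorUnitary : Matrix m m ℂ) *
    diagonal (fun i => ((g (ν - hZ.eigenvalues i) : ℝ) : ℂ)) *
    (hZ.eigenvectorUnitary : Matrix m m ℂ)ᴴ

theorem shiftFun_isHermitian (g : ℝ → ℝ) (ν : ℝ) : (shiftFun hZ g ν).IsHermitian := by
  rw [IsHermitian, shiftFun, conjTranspose_mul, conjTranspose_mul, conjTranspose_conjTranspose,
    diagonal_conjTranspose, ← Matrix.mul_assoc]
  congr 3; funext i
  simp

theorem shiftFun_mul (g g' : ℝ → ℝ) (ν : ℝ) :
    shiftFun hZ g ν * shiftFun hZ g' ν = shiftFun hZ (fun x => g x * g' x) ν := by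
  have h1 : (hZ.eigenvectorUnitary : Matrix m m ℂ)ᴴ * (hZ.eigenvectorUnitary : Matrix m m ℂ) = 1 :=
    Unitary.star_mul_self_of_mem hZ.eigenvectorUnitary.2
  simp only [shiftFun, Matrix.mul_assoc]
  rw [← Matrix.mul_assoc _ᴴ, h1, Matrix.one_mul, ← Matrix.mul_assoc (diagonal _) (diagonal _),
    diagonal_mul_diagonal]
  simp only [Complex.ofReal_mul]

theorem shiftFun_congr {g g' : ℝ → ℝ} {ν : ℝ} (hν : ∀ i, hZ.eigenvalues i < ν)
    (h : ∀ x, 0 < x → g x = g' x) : shiftFun hZ g ν = shiftFun hZ g' ν := by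
  unfold shiftFun
  congr 3; funext i
  rw [h _ (sub_pos.2 (hν i))]

theorem shiftFun_one (ν : ℝ) : shiftFun hZ (fun _ => 1) ν = 1 := by
  simp only [shiftFun, Complex.ofReal_one, diagonal_one, Matrix.mul_one]
  exact Unitary.mul_star_self_of_mem hZ.eigenvectorUnitary.2

theorem shiftFun_id (ν : ℝ) : shiftFun hZ (fun x => x) ν = -Z + ν • (1 : Matrix m m ℂ) :=
  (neg_add_smul_one_eq hZ ν).symm

theorem reTrace_shiftFun (g : ℝ → ℝ) (ν : ℝ) :
    reTrace (shiftFun hZ g ν) = ∑ i, g (ν - hZ.eigenvalues i) := by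
  have h1 : (hZ.eigenvectorUnitary : Matrix m m ℂ)ᴴ * (hZ.eigenvectorUnitary : Matrix m m ℂ) = 1 :=
    Unitary.star_mul_self_of_mem hZ.eigenvectorUnitary.2
  rw [reTrace, shiftFun, trace_mul_comm, ← Matrix.mul_assoc, h1, Matrix.one_mul, trace_diagonal,
    ← Complex.ofReal_sum, Complex.ofReal_re]

theorem continuousOn_shiftFun {g : ℝ → ℝ} (hg : ContinuousOn g (Set.Ioi 0)) :
    ContinuousOn (shiftFun hZ g) {ν | ∀ i, hZ.eigenvalues i < ν} := by
  have h : ContinuousOn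
      (fun ν : ℝ => (diagonal fun i => ((g (ν - hZ.eigenvalues i) : ℝ) : ℂ) : Matrix m m ℂ))
      {ν | ∀ i, hZ.eigenvalues i < ν} := by
    have h1 : ContinuousOn (fun ν : ℝ => fun i : m => ((g (ν - hZ.eigenvalues i) : ℝ) : ℂ))
        {ν | ∀ i, hZ.eigenvalues i < ν} := by
      refine continuousOn_pi.2 fun i => Complex.continuous_ofReal.comp_continuousOn
        (hg.comp (by fun_prop) fun ν hν => ?_)
      exact sub_pos.2 (hν i)
    exact (Continuous.matrix_diagonal continuous_id).comp_continuousOn h1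
  exact ((continuous_const.matrix_mul continuous_id).matrix_mul
    continuous_const).comp_continuousOn h

/-- The waterfilling solution written with `B = -Z + ν I` in place of a decomposition:
`B^{-1/2} [ρ I - B^{1/2} D⁻¹ B^{1/2}]⁺ B^{-1/2}`. -/
noncomputable def shiftWaterfill (ρ : ℝ) (D : Matrix m m ℂ) (ν : ℝ) : Matrix m m ℂ :=
  shiftFun hZ (fun x => (Real.sqrt x)⁻¹) ν *
    psdProj (ρ • (1 : Matrix m m ℂ) - shiftFun hZ Real.sqrt ν * D⁻¹ * shiftFun hZ Real.sqrt ν) *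
    shiftFun hZ (fun x => (Real.sqrt x)⁻¹) ν

/-- Only the fixed eigenbasis of `Z` enters the formula, so no continuous choice of `(V, Σ)` in `ν`
is needed. -/
theorem continuousOn_shiftWaterfill (ρ : ℝ) (D : Matrix m m ℂ) :
    ContinuousOn (shiftWaterfill hZ ρ D) {ν | ∀ i, hZ.eigenvalues i < ν} := by
  have hS := continuousOn_shiftFun hZ (g := Real.sqrt) Real.continuous_sqrt.continuousOn
  have hR := continuousOn_shiftFun hZ (g := fun x => (Real.sqrt x)⁻¹)
    (Real.continuous_sqrt.continuousOn.inv₀ fun x hx => (Real.sqrt_pos.2 hx).ne')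
  have hM : ContinuousOn (fun ν => ρ • (1 : Matrix m m ℂ) -
      shiftFun hZ Real.sqrt ν * D⁻¹ * shiftFun hZ Real.sqrt ν)
      {ν | ∀ i, hZ.eigenvalues i < ν} :=
    continuousOn_const.sub ((hS.mul continuousOn_const).mul hS)
  exact (hR.mul (continuous_psdProj.comp_continuousOn hM)).mul hR

/-- Here `S = B^{1/2}` and `R = B^{-1/2}`. Diagonalize `R D R = W Δ Wᴴ` and take `V = R W`;
inverting gives `S D⁻¹ S = W Δ⁻¹ Wᴴ`, and the projection commutes with conjugation by `W`. -/
theorem exists_isGenEigDecomp_of_sqrt {B S R : Matrix m m ℂ} (hD : D.PosDef) (hSS : S * S = B)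
    (hSR : S * R = 1) (hRH : Rᴴ = R) (ρ : ℝ) :
    ∃ (V : Matrix m m ℂ) (σ : m → ℝ), IsGenEigDecomp D B V σ ∧
      waterfill ρ V σ = R * psdProj (ρ • (1 : Matrix m m ℂ) - S * D⁻¹ * S) * R := by
  have hRS : R * S = 1 := mul_eq_one_comm.1 hSR
  have hC : (R * D * R).IsHermitian := by
    rw [IsHermitian, conjTranspose_mul, conjTranspose_mul, hRH, hD.1.eq, Matrix.mul_assoc]
  obtain ⟨W, δ, hWW, hspec'⟩ : ∃ (W : Matrix m m ℂ) (δ : m → ℝ), Wᴴ * W = 1 ∧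
      R * D * R = W * diagonal (fun i => (δ i : ℂ)) * Wᴴ :=
    ⟨_, _, Unitary.star_mul_self_of_mem hC.eigenvectorUnitary.2, eq_eigenvectorUnitary_mul hC⟩
  have hWW' : W * Wᴴ = 1 := mul_eq_one_comm.1 hWW
  obtain ⟨Δ, hΔ⟩ : ∃ Δ : Matrix m m ℂ, Δ = diagonal (fun i => (δ i : ℂ)) := ⟨_, rfl⟩
  have hspec : R * D * R = W * Δ * Wᴴ := by rw [hspec', hΔ]
  have hdec : IsGenEigDecomp D B (R * W) δ := by
    rw [IsGenEigDecomp, ← hΔ]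
    refine ⟨?_, ?_⟩
    · calc D * (R * W) = S * R * D * R * W := by
            rw [hSR]; simp only [Matrix.one_mul, Matrix.mul_assoc]
        _ = S * (R * D * R) * W := by simp only [Matrix.mul_assoc]
        _ = S * W * Δ * (Wᴴ * W) := by rw [hspec]; simp only [Matrix.mul_assoc]
        _ = S * (S * R) * W * Δ := by rw [hWW, hSR]; simp only [Matrix.mul_one]
        _ = (S * S) * (R * W) * Δ := by simp only [Matrix.mul_assoc]
        _ = _ := by rw [hSS]
    · rw [← hSS, conjTranspose_mul, hRH]
      calc Wᴴ * R * (S * S) * (R * W) = Wᴴ * (R * S) * (S * R) * W := by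
            simp only [Matrix.mul_assoc]
        _ = 1 := by rw [hRS, hSR, Matrix.mul_one, Matrix.mul_one, hWW]
  refine ⟨R * W, δ, hdec, ?_⟩
  have hσ : ∀ i, δ i ≠ 0 := fun i => (hdec.pos hD i).ne'
  have hΔinv : Δ⁻¹ * Δ = 1 := by rw [hΔ, inv_diagonal_ofReal hσ, diagonal_inv_mul hσ]
  have hDinv : D * D⁻¹ = 1 := mul_nonsing_inv _ ((isUnit_iff_isUnit_det _).1 hD.isUnit)
  have h1 : W * Δ⁻¹ * Wᴴ = S * D⁻¹ * S := by
    have hl : W * Δ⁻¹ * Wᴴ * (R * D * R) = 1 := by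
      rw [hspec]
      calc W * Δ⁻¹ * Wᴴ * (W * Δ * Wᴴ) = W * Δ⁻¹ * (Wᴴ * W) * Δ * Wᴴ := by
            simp only [Matrix.mul_assoc]
        _ = W * (Δ⁻¹ * Δ) * Wᴴ := by rw [hWW]; simp only [Matrix.mul_one, Matrix.mul_assoc]
        _ = 1 := by rw [hΔinv, Matrix.mul_one, hWW']
    have hr : R * D * R * (S * D⁻¹ * S) = 1 := by
      calc R * D * R * (S * D⁻¹ * S) = R * D * (R * S) * D⁻¹ * S := by
            simp only [Matrix.mul_assoc]
        _ = R * (D * D⁻¹) * S := by rw [hRS]; simp only [Matrix.mul_one, Matrix.mul_assoc]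
        _ = 1 := by rw [hDinv, Matrix.mul_one, hRS]
    exact left_inv_eq_right_inv hl hr
  have h2 : W * (ρ • (1 : Matrix m m ℂ) - Δ⁻¹) * Wᴴ = ρ • (1 : Matrix m m ℂ) - S * D⁻¹ * S := by
    rw [Matrix.mul_sub, Matrix.sub_mul, h1, Matrix.mul_smul, Matrix.smul_mul, Matrix.mul_one, hWW']
  rw [waterfill, ← hΔ, conjTranspose_mul, hRH, ← h2, psdProj_unitary_conj hWW]
  simp only [Matrix.mul_assoc]

theorem exists_isGenEigDecomp (hD : D.PosDef) {ν : ℝ} (hν : ∀ i, hZ.eigenvalues i < ν) (ρ : ℝ) :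
    ∃ (V : Matrix m m ℂ) (σ : m → ℝ), IsGenEigDecomp D (-Z + ν • (1 : Matrix m m ℂ)) V σ ∧
      waterfill ρ V σ = shiftWaterfill hZ ρ D ν := by
  refine exists_isGenEigDecomp_of_sqrt hD ?_ ?_ (shiftFun_isHermitian hZ _ ν) ρ
  · rw [shiftFun_mul, ← shiftFun_id hZ]
    exact shiftFun_congr hZ hν fun x hx => Real.mul_self_sqrt hx.le
  · rw [shiftFun_mul, ← shiftFun_one hZ ν]
    exact shiftFun_congr hZ hν fun x hx => mul_inv_cancel₀ (Real.sqrt_pos.2 hx).ne'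

theorem inv_neg_add_smul_one {ν : ℝ} (hν : ∀ i, hZ.eigenvalues i < ν) :
    (-Z + ν • (1 : Matrix m m ℂ))⁻¹ = shiftFun hZ (fun x => x⁻¹) ν := by
  refine inv_eq_left_inv ?_
  rw [← shiftFun_id hZ, shiftFun_mul, ← shiftFun_one hZ ν]
  exact shiftFun_congr hZ hν fun x hx => inv_mul_cancel₀ hx.ne'

/-- Once `ν ≥ ρ λ_max(D) + λ_max(Z)`, waterfilling allocates no power. -/
theorem IsGenEigDecomp.waterfill_eq_zero_of_le {V : Matrix m m ℂ} {σ : m → ℝ} {ν ρ : ℝ}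
    (h : IsGenEigDecomp D (-Z + ν • (1 : Matrix m m ℂ)) V σ) (hD : D.PosDef) (hρ : 0 < ρ)
    (hν : ρ * lamMax hD.isHermitian + lamMax hZ ≤ ν) : waterfill ρ V σ = 0 := by
  refine h.waterfill_eq_zero hD ?_
  have h1 := ((posSemidef_neg_add_smul_one_iff hD.isHermitian (lamMax hD.isHermitian)).2 fun i =>
    eigenvalues_le_lamMax _ i).smul hρ.le
  have h2 := (posSemidef_neg_add_smul_one_iff hZ (ν - ρ * lamMax hD.isHermitian)).2 fun i =>
    (eigenvalues_le_lamMax _ i).trans (by linarith)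
  convert h1.add h2 using 1
  rw [smul_add, smul_neg, smul_smul, sub_smul]
  abel

/-- As `ν` decreases to the largest eigenvalue of `Z` the allocated power exceeds every bound. -/
theorem exists_le_reTrace_shiftWaterfill [Nonempty m] (hD : D.PosDef) {ρ : ℝ} (hρ : 0 < ρ)
    (P : ℝ) : ∃ ν, lamMax hZ < ν ∧ P ≤ reTrace (shiftWaterfill hZ ρ D ν) := by
  -- At `ν = lamMax hZ + c⁻¹` the inverse of `-Z + ν I` has eigenvalue `c`, and `ρ c - tr D⁻¹ ≥ P`.
  -- The `1` only ensures `c > 0`.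
  set c := max ((P + reTrace D⁻¹) / ρ) 1 with hc
  have hc0 : 0 < c := lt_max_of_lt_right one_pos
  have hcinv : 0 < c⁻¹ := inv_pos.2 hc0
  have hν : ∀ i, hZ.eigenvalues i < lamMax hZ + c⁻¹ := fun i => by
    linarith [eigenvalues_le_lamMax hZ i]
  refine ⟨lamMax hZ + c⁻¹, by linarith, ?_⟩
  obtain ⟨V, σ, hdec, hw⟩ := exists_isGenEigDecomp hZ hD hν ρ
  have h1 := hdec.le_reTrace_waterfill hD ρ
  rw [hw, inv_neg_add_smul_one hZ hν, reTrace_shiftFun] at h1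
  obtain ⟨i, hi⟩ := exists_eigenvalues_eq_lamMax hZ
  have h2 := Finset.single_le_sum (f := fun i => (lamMax hZ + c⁻¹ - hZ.eigenvalues i)⁻¹)
    (fun j _ => inv_nonneg.2 (sub_pos.2 (hν j)).le) (Finset.mem_univ i)
  simp only [hi, add_sub_cancel_left, inv_inv] at h2
  have h3 : (P + reTrace D⁻¹) / ρ ≤ c := le_max_left _ _
  rw [div_le_iff₀ hρ] at h3
  nlinarith

theorem exists_multiplier_objY {P ρ : ℝ} (hP : 0 < P) (hρ : 0 < ρ) (hD : D.PosDef) :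
    ∃ (μ : ℝ) (Y : Matrix m m ℂ),
      argmaxOn (objY ρ D Z) (powerSet P) = {Y} ∧
      (∃ (V : Matrix m m ℂ) (σ : m → ℝ),
        IsGenEigDecomp D (-Z + μ • (1 : Matrix m m ℂ)) V σ) ∧
      (∀ (V : Matrix m m ℂ) (σ : m → ℝ),
        IsGenEigDecomp D (-Z + μ • (1 : Matrix m m ℂ)) V σ → Y = waterfill ρ V σ) ∧
      (∀ ν : ℝ, IsTraceMultiplier (objY ρ D Z) P Y ν ↔ ν = μ) ∧
      (∀ ν : ℝ, (∃ W, IsClosedY ρ D Z ν W ∧ TraceCompl P W ν) ↔ ν = μ) ∧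
      (ρ ≤ 1 →
        let lo := max (lamMax hZ) 0
        let hi := max (lamMax hD.isHermitian + lamMax hZ / ρ) 0
        μ ∈ Set.Icc lo hi ∧
        ∀ t : ℕ,
          let I := bisect (fun ν => ∃ W, IsClosedY ρ D Z ν W ∧ P < reTrace W) lo hi t
          (∃! W, IsClosedY ρ D Z (midpt I) W) ∧
          μ ∈ Set.Icc I.1 I.2 ∧ I.2 - I.1 = (hi - lo) / 2 ^ t) := by
  set S : Set ℝ := {ν | ∀ i, hZ.eigenvalues i < ν} with hS
  have hSup : IsUpperSet S := fun ν c hνc hν i => (hν i).trans_le hνc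
  have hSmem : ∀ {ν : ℝ}, lamMax hZ < ν → ν ∈ S := fun h i =>
    (eigenvalues_le_lamMax hZ i).trans_lt h
  have hX : ∀ ν ∈ S, argmaxOn (fun W => objY ρ D Z W - ν * (reTrace W - P))
      {W : Matrix m m ℂ | W.PosSemidef} = {shiftWaterfill hZ ρ D ν} := by
    intro ν hν
    obtain ⟨V, σ, hdec, hw⟩ := exists_isGenEigDecomp hZ hD hν ρ
    rw [← hw, argmaxOn_objY_sub hdec hD hZ hρ]
  have hXc : ∀ ν ∉ S, argmaxOn (fun W => objY ρ D Z W - ν * (reTrace W - P))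
      {W : Matrix m m ℂ | W.PosSemidef} = ∅ := fun ν hν =>
    argmaxOn_objY_sub_eq_empty hZ hD hρ fun h => hν ((posDef_neg_add_smul_one_iff hZ ν).1 h)
  -- The formula does not depend on the decomposition, because each one yields the unique maximizer
  -- of the same Lagrangian.
  have hdecS : ∀ {ν : ℝ} {V : Matrix m m ℂ} {σ : m → ℝ},
      IsGenEigDecomp D (-Z + ν • (1 : Matrix m m ℂ)) V σ →
      ν ∈ S ∧ waterfill ρ V σ = shiftWaterfill hZ ρ D ν := by
    intro ν V σ hdec
    have hν : ν ∈ S := (posDef_neg_add_smul_one_iff hZ ν).1 hdec.posDef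
    refine ⟨hν, ?_⟩
    rw [← Set.singleton_eq_singleton_iff, ← hX ν hν, argmaxOn_objY_sub hdec hD hZ hρ]
  have hclosed : ∀ ν W, IsClosedY ρ D Z ν W ↔ ν ∈ S ∧ W = shiftWaterfill hZ ρ D ν := by
    refine fun ν W => ⟨?_, ?_⟩
    · rintro ⟨V, σ, hdec, rfl⟩
      exact hdecS hdec
    · rintro ⟨hν, rfl⟩
      obtain ⟨V, σ, hdec, hw⟩ := exists_isGenEigDecomp hZ hD hν ρ
      exact ⟨V, σ, hdec, hw.symm⟩
  have hzero : ∀ ν ∈ S, ρ * lamMax hD.isHermitian + lamMax hZ ≤ ν →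
      shiftWaterfill hZ ρ D ν = 0 := by
    intro ν hν hle
    obtain ⟨V, σ, hdec, hw⟩ := exists_isGenEigDecomp hZ hD hν ρ
    rw [← hw, hdec.waterfill_eq_zero_of_le hZ hD hρ hle]
  have hlarge : ∀ᶠ b in Filter.atTop, reTrace (shiftWaterfill hZ ρ D b) ≤ P := by
    filter_upwards [Filter.eventually_gt_atTop (lamMax hZ),
      Filter.eventually_ge_atTop (ρ * lamMax hD.isHermitian + lamMax hZ)] with b hb hb'
    rw [hzero b (hSmem hb) hb', reTrace_zero]
    exact hP.le
  have hsmall : ∃ ν ∈ S, 0 ≤ ν ∧ (ν = 0 ∨ P ≤ reTrace (shiftWaterfill hZ ρ D ν)) := by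
    by_cases h0 : (0 : ℝ) ∈ S
    · exact ⟨0, h0, le_rfl, Or.inl rfl⟩
    -- Now `lamMax hZ ≥ 0`, so the points just above it, where the trace reaches `P`, are admissible
    -- multipliers.
    · have h1 : ∃ i, 0 ≤ hZ.eigenvalues i := by simpa [hS] using h0
      obtain ⟨i, hi⟩ := h1
      have : Nonempty m := ⟨i⟩
      obtain ⟨ν, hν, hle⟩ := exists_le_reTrace_shiftWaterfill hZ hD hρ P
      exact ⟨ν, hSmem hν, (hi.trans (eigenvalues_le_lamMax hZ i)).trans hν.le, Or.inr hle⟩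
  obtain ⟨μ, hμS, hμ, h1, h2, h3, h4⟩ := exists_traceMultiplier hP hSup hX hXc
    (fun W hW => differentiableAt_objY_smul hD hW)
    (continuous_reTrace.comp_continuousOn (continuousOn_shiftWaterfill hZ ρ D)) hlarge hsmall
  refine ⟨μ, shiftWaterfill hZ ρ D μ, h1, ?_, fun V σ hdec => (hdecS hdec).2.symm, h2,
    fun ν => ⟨?_, ?_⟩, fun hρ1 => ?_⟩
  · obtain ⟨V, σ, hdec, -⟩ := exists_isGenEigDecomp hZ hD hμS ρ
    exact ⟨V, σ, hdec⟩
  · rintro ⟨W, hW, hc⟩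
    obtain ⟨hν, rfl⟩ := (hclosed ν W).1 hW
    exact (h3 ν hν).1 hc
  · rintro rfl
    exact ⟨_, (hclosed ν _).2 ⟨hμS, rfl⟩, hμ⟩
  · intro lo hi
    have hlo : lo ≤ μ := by
      refine max_le ?_ hμ.1
      rcases isEmpty_or_nonempty m with he | he
      · simpa [lamMax] using hμ.1
      · obtain ⟨i, hi⟩ := exists_eigenvalues_eq_lamMax hZ
        exact hi ▸ (hμS i).le
    have hhi : μ ≤ hi := by
      rcases hμ.1.eq_or_lt with h0 | h0
      · exact h0 ▸ le_max_right _ _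
      · refine le_max_of_le_left ?_
        -- The natural threshold is `ρ λ_max(D) + λ_max(Z)`. If `μ` exceeded the stated bound, then
        -- `ρ μ ≤ μ` (from `ρ ≤ 1`) would put it past this threshold, where the trace is `0` and
        -- complementarity fails.
        by_contra! hlt
        have hle : ρ * lamMax hD.isHermitian + lamMax hZ ≤ μ := by
          have h5 : ρ * (lamMax hD.isHermitian + lamMax hZ / ρ) ≤ ρ * μ :=
            mul_le_mul_of_nonneg_left hlt.le hρ.le
          rw [mul_add, mul_div_cancel₀ _ hρ.ne'] at h5
          nlinarith
        have h6 := hμ.2.2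
        rw [hzero μ hμS hle, reTrace_zero] at h6
        rcases mul_eq_zero.1 h6 with h | h <;> linarith
    refine ⟨⟨hlo, hhi⟩, fun t => ?_⟩
    -- `lo` may equal `lamMax hZ` and lie outside `S`; since `μ` is strictly above the spectrum, so
    -- is every midpoint.
    have hmidS : ∀ ν, (lo + μ) / 2 ≤ ν → ν ∈ S := by
      intro ν hν i
      have h5 : hZ.eigenvalues i ≤ lo := (eigenvalues_le_lamMax hZ i).trans (le_max_left _ _)
      linarith [hμS i]
    have hlo0 : 0 ≤ lo := le_max_right _ _
    have hiff : ∀ ν ∈ S, (∃ W, IsClosedY ρ D Z ν W ∧ P < reTrace W) ↔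
        P < reTrace (shiftWaterfill hZ ρ D ν) := by
      refine fun ν hν => ⟨?_, fun h => ⟨_, (hclosed ν _).2 ⟨hν, rfl⟩, h⟩⟩
      rintro ⟨W, hW, h⟩
      rwa [((hclosed ν W).1 hW).2] at h
    obtain ⟨g1, g2, g3⟩ := bisect_spec
      (above := fun ν => ∃ W, IsClosedY ρ D Z ν W ∧ P < reTrace W) ⟨hlo, hhi⟩
      (fun ν hν => by
        have hνS := hmidS ν hν
        simp only [hiff ν hνS]
        exact h4 ν hνS (by linarith [hμ.1])) t
    refine ⟨⟨_, (hclosed _ _).2 ⟨hmidS _ ?_, rfl⟩, fun W hW => ((hclosed _ W).1 hW).2⟩, g2, g3⟩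
    have := g2.2
    unfold midpt
    linarith

end shift

theorem lemma1 {m k : Type*} [Fintype m] [Fintype k] [DecidableEq m] [DecidableEq k]
    (P ρ τ : ℝ) (hP : 0 < P) (hρ : 0 < ρ) (hτ : 0 < τ)
    (D₁ Z : Matrix m m ℂ) (hD : D₁.PosDef) (hZ : Z.IsHermitian)
    (Xc : Matrix (m ⊕ k) (m ⊕ k) ℂ) (hX : Xc.IsHermitian) :
    -- part (i)
    (∃ μ : ℝ,
      argmaxOn (objX τ Xc Z) (powerSet P) = {closedX τ Xc Z μ} ∧
      (∀ ν : ℝ, IsTraceMultiplier (objX τ Xc Z) P (closedX τ Xc Z μ) ν ↔ ν = μ) ∧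
      (∀ ν : ℝ, TraceCompl P (closedX τ Xc Z ν) ν ↔ ν = μ) ∧
      (∀ᶠ b : ℝ in Filter.atTop, reTrace (closedX τ Xc Z b) ≤ P) ∧
      (∀ b : ℝ, 0 ≤ b → reTrace (closedX τ Xc Z b) ≤ P → ∀ t : ℕ,
        let I := bisect (fun ν => P < reTrace (closedX τ Xc Z ν)) 0 b t
        μ ∈ Set.Icc I.1 I.2 ∧ I.2 - I.1 = b / 2 ^ t)) ∧
    -- part (ii)
    (∃ (μ : ℝ) (Y : Matrix m m ℂ),
      argmaxOn (objY ρ D₁ Z) (powerSet P) = {Y} ∧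
      (∃ (V : Matrix m m ℂ) (σ : m → ℝ),
        IsGenEigDecomp D₁ (-Z + μ • (1 : Matrix m m ℂ)) V σ) ∧
      (∀ (V : Matrix m m ℂ) (σ : m → ℝ),
        IsGenEigDecomp D₁ (-Z + μ • (1 : Matrix m m ℂ)) V σ → Y = waterfill ρ V σ) ∧
      (∀ ν : ℝ, IsTraceMultiplier (objY ρ D₁ Z) P Y ν ↔ ν = μ) ∧
      (∀ ν : ℝ, (∃ W, IsClosedY ρ D₁ Z ν W ∧ TraceCompl P W ν) ↔ ν = μ) ∧
      (ρ ≤ 1 →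
        let lo := max (lamMax hZ) 0
        let hi := max (lamMax hD.isHermitian + lamMax hZ / ρ) 0
        μ ∈ Set.Icc lo hi ∧
        ∀ t : ℕ,
          let I := bisect (fun ν => ∃ W, IsClosedY ρ D₁ Z ν W ∧ P < reTrace W) lo hi t
          (∃! W, IsClosedY ρ D₁ Z (midpt I) W) ∧
          μ ∈ Set.Icc I.1 I.2 ∧ I.2 - I.1 = (hi - lo) / 2 ^ t)) :=
  ⟨exists_multiplier_objX hP hτ hZ hX, exists_multiplier_objY hZ hP hρ hD⟩
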